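/- Let $d\ge 1$, let $\Xi_d$ be the set of nonempty, open, bounded and connected subsets of $\mathbb R^d$, and let $\Omega\in\Xi_d$ or $\Omega=\mathbb R^d$. For $\omega\in\Xi_d$, let $\sigma(\omega,0)=(\lambda_j(\omega,0))_{j\in\mathbb N}$ be the non-decreasing sequence of eigenvalues of $-\Delta$ on $\omega$ with Dirichlet boundary conditions, counted with multiplicity, and let $(\phi_j(\omega,0))_{j\in\mathbb N}$ be a corresponding orthonormal basis of $L^2(\omega)$ made of real-valued eigenfunctions (weak eigenfunctions in $H^1_0(\omega)$). A function $Z:\Omega\to\mathbb R$ is called absolutely continuous on $\Omega$ (in the sense of Tonelli) if it is continuous on $\Omega$, if for each $i\in\{1,\dots,d\}$ and almost every line parallel to the $i$-th coordinate axis it is absolutely continuous on every compact segment of that line contained in $\Omega$, and if its partial derivatives, which then exist almost everywhere, belong to $L^1_{\mathrm{loc}}(\Omega)$. Let $Z$ be non-constant and absolutely continuous on $\Omega$. Then there exist $\omega\in\Xi_d$ compactly contained in $\Omega$, which is an open orthotope (a product of bounded open intervals in some orthonormal coordinate system of $\mathbb R^d$) and in particular has Lipschitz continuous boundary, and a bijection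 $h:\mathbb N\to\mathbb N$ such that $-\Delta$ on $\omega$ with Dirichlet boundary conditions has a basis $(\phi_j(\omega,0))_{j\in\mathbb N}$ of eigenfunctions as above, its spectrum $\sigma(\omega,0)$ is simple (all eigenspaces are one-dimensional), and, for every such choice of the sequence of eigenfunctions (they are unique up to sign), $$\int_\omega Z\,\phi_{h(l)}(\omega,0)\,\phi_{h(l+1)}(\omega,0)\,dx\neq 0\qquad\text{for every } l\in\mathbb N .$$ -/

import Mathlib

open MeasureTheory Set Filter Topology
open scoped ENNReal

/-- Euclidean space `ℝ^d`. -/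
abbrev Eucl (d : ℕ) : Type := EuclideanSpace ℝ (Fin d)

/-- The class `Ξ_d` of nonempty, open, bounded and connected subsets of `ℝ^d`. -/
structure IsBoundedDomain {d : ℕ} (Ω : Set (Eucl d)) : Prop where
  nonempty : Ω.Nonempty
  isOpen : IsOpen Ω
  isBounded : Bornology.IsBounded Ω
  isConnected : IsConnected Ω

/-- The class `Ξ_d^∞ = Ξ_d ∪ {ℝ^d}`. -/
def IsBoundedDomainOrUniv {d : ℕ} (Ω : Set (Eucl d)) : Prop :=
  IsBoundedDomain Ω ∨ Ω = univ

/-- `ω ⊂⊂ Ω`. -/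
def CompactlyContained {d : ℕ} (ω Ω : Set (Eucl d)) : Prop :=
  IsCompact (closure ω) ∧ closure ω ⊆ Ω

/-- `Z` is absolutely continuous on the open set `Ω ⊆ ℝ^d` (in the sense of Tonelli): it is
continuous on `Ω`; for each coordinate direction `e_i` it is absolutely continuous on every compact
segment contained in `Ω` of almost every line parallel to `e_i`; and its partial derivatives
(which then exist almost everywhere in `Ω`) are locally integrable on `Ω`.
A condition on the whole line `x + ℝ e_i` holds for almost every `x ∈ ℝ^d` if and only if it holds
for almost every such line with respect to the `(d-1)`-dimensional measure. In dimension one this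
is absolute continuity on each compact interval contained in `Ω`. -/
structure IsAbsolutelyContinuousOn {d : ℕ} (Z : Eucl d → ℝ) (Ω : Set (Eucl d)) : Prop where
  continuousOn : ContinuousOn Z Ω
  acOnLines : ∀ i : Fin d, ∀ᵐ x : Eucl d, ∀ a b : ℝ, a ≤ b →
    (∀ t ∈ Icc a b, x + t • EuclideanSpace.single i (1 : ℝ) ∈ Ω) →
    AbsolutelyContinuousOnInterval
      (fun t : ℝ => Z (x + t • EuclideanSpace.single i (1 : ℝ))) a b
  locallyIntegrable : ∀ i : Fin d,
    LocallyIntegrableOn (fun x => lineDeriv ℝ Z x (EuclideanSpace.single i (1 : ℝ))) Ω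

/-- An open `d`-orthotope: a product of bounded open intervals in some orthonormal coordinate
system of `ℝ^d`. -/
def IsOrthotope {d : ℕ} (ω : Set (Eucl d)) : Prop :=
  ∃ (b : OrthonormalBasis (Fin d) ℝ (Eucl d)) (c : Eucl d) (r : Fin d → ℝ),
    (∀ i, 0 < r i) ∧ ω = {x | ∀ i, inner ℝ (b i) (x - c) ∈ Ioo 0 (r i)}

/-- The open set `ω` has Lipschitz continuous boundary: near each boundary point, `ω` is the part
strictly above the graph of a Lipschitz function over the hyperplane orthogonal to some unit
vector `e`; here `inner ℝ e y` is the height of `y` and `y - inner ℝ e y • e` its projection on the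
hyperplane. -/
def HasLipschitzBoundary {d : ℕ} (ω : Set (Eucl d)) : Prop :=
  ∀ x ∈ frontier ω, ∃ (ρ : ℝ) (e : Eucl d) (K : NNReal) (g : Eucl d → ℝ),
    0 < ρ ∧ ‖e‖ = 1 ∧ LipschitzWith K g ∧
      ∀ y ∈ Metric.ball x ρ, (y ∈ ω ↔ g (y - inner ℝ e y • e) < inner ℝ e y)

/-- `ψ ∈ C_c^∞(ω)`. -/
structure IsTestFunction {d : ℕ} (ω : Set (Eucl d)) (ψ : Eucl d → ℝ) : Prop where
  contDiff : ContDiff ℝ (⊤ : ℕ∞) ψ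
  hasCompactSupport : HasCompactSupport ψ
  tsupport_subset : tsupport ψ ⊆ ω

/-- `G` is the weak gradient of `u` on `ω`. -/
def HasWeakGradientOn {d : ℕ} (ω : Set (Eucl d)) (u : Eucl d → ℝ) (G : Eucl d → Eucl d) : Prop :=
  ∀ ψ : Eucl d → ℝ, IsTestFunction ω ψ →
    ∫ x in ω, u x • gradient ψ x = -∫ x in ω, ψ x • G x

/-- `u ∈ H^1_0(ω)` with weak gradient `G`: `u` belongs to `H^1(ω)`, and to the closure
of `C_c^∞(ω)` in the `H^1` norm. -/
structure MemH10 {d : ℕ} (ω : Set (Eucl d)) (u : Eucl d → ℝ) (G : Eucl d → Eucl d) : Prop where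
  memLp : MemLp u 2 (volume.restrict ω)
  memLp_grad : MemLp G 2 (volume.restrict ω)
  hasWeakGradientOn : HasWeakGradientOn ω u G
  approx : ∀ ε : ℝ≥0∞, 0 < ε → ∃ ψ : Eucl d → ℝ, IsTestFunction ω ψ ∧
    eLpNorm (fun x => u x - ψ x) 2 (volume.restrict ω) < ε ∧
    eLpNorm (fun x => G x - gradient ψ x) 2 (volume.restrict ω) < ε

/-- `u ∈ H^1_0(ω)` and `-Δ u = μ u` weakly on `ω`, i.e. `u` is zero or an eigenfunction, with
eigenvalue `μ`, of the Dirichlet Laplacian `-Δ` on `ω`. -/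
def InDirichletEigenspace {d : ℕ} (ω : Set (Eucl d)) (μ : ℝ) (u : Eucl d → ℝ) : Prop :=
  ∃ G : Eucl d → Eucl d, MemH10 ω u G ∧
    ∀ ψ : Eucl d → ℝ, IsTestFunction ω ψ →
      ∫ x in ω, inner ℝ (G x) (gradient ψ x) = μ * ∫ x in ω, u x * ψ x

/-- The Dirichlet spectrum `σ(ω, 0)` is simple: all eigenspaces are at most one-dimensional. -/
def HasSimpleDirichletSpectrum {d : ℕ} (ω : Set (Eucl d)) : Prop :=
  ∀ (μ : ℝ) (u v : Eucl d → ℝ), InDirichletEigenspace ω μ u → InDirichletEigenspace ω μ v →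
    ∃ a b : ℝ, (a, b) ≠ (0, 0) ∧ ∀ᵐ x ∂(volume.restrict ω), a * u x + b * v x = 0

/-- `(lam j)` is the non-decreasing sequence `(λ_j(ω, 0))` of the eigenvalues of `-Δ` on `ω` with
Dirichlet boundary conditions, counted with multiplicity, and `(φ j)` is a corresponding
orthonormal basis `(φ_j(ω, 0))` of `L²(ω)` made of real-valued eigenfunctions. The indices start at
`0` instead of `1`. -/
structure IsDirichletEigenbasis {d : ℕ} (ω : Set (Eucl d)) (lam : ℕ → ℝ)
    (φ : HilbertBasis ℕ ℝ (Lp ℝ 2 (volume.restrict ω))) : Prop where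
  monotone : Monotone lam
  eigen : ∀ j : ℕ, InDirichletEigenspace ω (lam j) (φ j)

/-! The box is tiny and centred on the behaviour of `Z` at one point. Near a suitable point `c`, the
function `Z` is affine with nonzero slope `g`, up to an error that is small in mean
(`exists_L1_differentiable_point`). Such a point exists because Lebesgue points of the partial
derivatives and an `L¹` Poincaré inequality (`exists_lintegral_sub_affine_le`) give the expansion
almost everywhere. If the partial derivatives vanished almost everywhere on every ball, the same
inequality would make `Z` locally constant, hence constant.

On a box the eigenfunctions are products of sines, indexed by `ℕ^d`. Suppose two indices differ by
one in a single direction `i`. In the affine part of `Z`, the constant drops out by orthogonality,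
and the linear part integrates to `-(inner (b i) g) * (r i / π²) * C` with `C ≥ 16/9`, uniformly in
the indices (`integral_inner_boxMode_mul_of_adj`). Products of two modes are bounded uniformly as
well. For a box of size `ε` the linear term therefore has order `ε`, while the remainder contributes
at most a small multiple of `ε`. A single box thus makes all couplings between grid neighbours
nonzero at once (`coupling_ne_zero`), provided that no axis of the box is orthogonal to `g`
(`exists_orthonormalBasis_inner_ne_zero`).

It remains to arrange the spectrum and the order. Side ratios that are powers of a transcendental
number make the eigenvalues pairwise distinct (`exists_sides_injective`). The modes are complete by
Stone–Weierstrass (`ae_eq_zero_of_integral_boxMode`), so every admissible eigenbasis consists of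
them, up to nonzero factors and in the order of the eigenvalues (`dirichletEigenbasis_box_unique`).
Finally `ℕ^d` has a path through all its vertices with steps between neighbours
(`exists_grid_path`), and `h` reads this path in the order of the eigenvalues. -/

/-! ### An `L¹` Poincaré inequality on cubes -/

section Poincare

variable {ι : Type*} [DecidableEq ι]

/-- The exchange of the coordinates in `s` between two points. -/
def swapOn (s : Finset ι) (p : (ι → ℝ) × (ι → ℝ)) : (ι → ℝ) × (ι → ℝ) :=
  (s.piecewise p.2 p.1, s.piecewise p.1 p.2)

lemma swapOn_involutive (s : Finset ι) : Function.Involutive (swapOn s) := by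
  intro p
  ext i <;> by_cases hi : i ∈ s <;> simp [swapOn, hi]

variable [Fintype ι]

/-- Seen as a map on functions with values in pairs, the exchange acts on each factor separately, by
the swap or by the identity. -/
lemma measurePreserving_swapOn (μ : ι → Measure ℝ) [∀ i, IsProbabilityMeasure (μ i)]
    (s : Finset ι) :
    MeasurePreserving (swapOn s) ((Measure.pi μ).prod (Measure.pi μ))
      ((Measure.pi μ).prod (Measure.pi μ)) := by
  have h1 := measurePreserving_arrowProdEquivProdArrow ℝ ℝ ι μ μ
  have h2 : MeasurePreserving (fun (a : ι → ℝ × ℝ) i => (if i ∈ s then Prod.swap else id) (a i))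
      (Measure.pi fun i => (μ i).prod (μ i)) (Measure.pi fun i => (μ i).prod (μ i)) := by
    refine measurePreserving_pi _ _ (f := fun i => if i ∈ s then Prod.swap else id) fun i => ?_
    by_cases hi : i ∈ s
    · simpa [hi] using Measure.measurePreserving_swap
    · simpa [hi] using MeasurePreserving.id _
  have h3 := h1.comp (h2.comp h1.symm)
  convert! h3 using 1
  funext p
  ext i <;> by_cases hi : i ∈ s <;>
    simp [swapOn, hi, MeasurableEquiv.arrowProdEquivProdArrow, Equiv.arrowProdEquivProdArrow]

lemma lintegral_swapOn (μ : ι → Measure ℝ) [∀ i, IsProbabilityMeasure (μ i)]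
    (s : Finset ι) (f : (ι → ℝ) × (ι → ℝ) → ℝ≥0∞) :
    ∫⁻ p, f (swapOn s p) ∂((Measure.pi μ).prod (Measure.pi μ)) =
      ∫⁻ p, f p ∂((Measure.pi μ).prod (Measure.pi μ)) := by
  have h := measurePreserving_swapOn μ s
  exact h.lintegral_comp_emb
    (MeasurableEquiv.ofInvolutive _ (swapOn_involutive s) h.measurable).measurableEmbedding f

lemma measurePreserving_piecewise (μ : ι → Measure ℝ) [∀ i, IsProbabilityMeasure (μ i)]
    (s : Finset ι) :
    MeasurePreserving (fun p : (ι → ℝ) × (ι → ℝ) => s.piecewise p.2 p.1)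
      ((Measure.pi μ).prod (Measure.pi μ)) (Measure.pi μ) :=
  measurePreserving_fst.comp (measurePreserving_swapOn μ s)

/-- Telescoping: the coordinates of the first point are replaced one at a time by those of the
second. The step at `j` compares two points that differ only there, and the measure-preserving
exchange `swapOn s` turns it into the summand of index `j`. -/
lemma lintegral_sub_le_sum_update (μ : ι → Measure ℝ) [∀ i, IsProbabilityMeasure (μ i)]
    {W : (ι → ℝ) → ℝ} (hW : AEMeasurable W (Measure.pi μ)) :
    ∫⁻ p, ‖W p.1 - W p.2‖ₑ ∂((Measure.pi μ).prod (Measure.pi μ)) ≤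
      ∑ j, ∫⁻ p, ‖W p.1 - W (Function.update p.1 j (p.2 j))‖ₑ
        ∂((Measure.pi μ).prod (Measure.pi μ)) := by
  have key : ∀ s : Finset ι,
      ∫⁻ p, ‖W p.1 - W (s.piecewise p.2 p.1)‖ₑ ∂((Measure.pi μ).prod (Measure.pi μ)) ≤
      ∑ j ∈ s, ∫⁻ p, ‖W p.1 - W (Function.update p.1 j (p.2 j))‖ₑ
        ∂((Measure.pi μ).prod (Measure.pi μ)) := by
    intro s
    induction s using Finset.induction_on with
    | empty => simp
    | insert j s hj ih =>
      rw [Finset.sum_insert hj, add_comm]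
      have h1 : ∀ p : (ι → ℝ) × (ι → ℝ), ‖W p.1 - W ((insert j s).piecewise p.2 p.1)‖ₑ ≤
          ‖W p.1 - W (s.piecewise p.2 p.1)‖ₑ + ‖W (swapOn s p).1 -
            W (Function.update (swapOn s p).1 j ((swapOn s p).2 j))‖ₑ := by
        intro p
        have : (insert j s).piecewise p.2 p.1 =
            Function.update (swapOn s p).1 j ((swapOn s p).2 j) := by
          rw [Finset.piecewise_insert]
          simp [swapOn, hj]
        rw [this]
        refine le_trans (le_of_eq ?_) (enorm_add_le _ _)
        simp [swapOn]
      have hm : AEMeasurable (fun p : (ι → ℝ) × (ι → ℝ) => ‖W p.1 - W (s.piecewise p.2 p.1)‖ₑ)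
          ((Measure.pi μ).prod (Measure.pi μ)) := by
        refine AEMeasurable.enorm (AEMeasurable.sub ?_ ?_)
        · exact hW.comp_quasiMeasurePreserving measurePreserving_fst.quasiMeasurePreserving
        · exact hW.comp_quasiMeasurePreserving
            (measurePreserving_piecewise μ s).quasiMeasurePreserving
      refine (lintegral_mono h1).trans ?_
      rw [lintegral_add_left' hm]
      refine add_le_add ih (le_of_eq ?_)
      exact lintegral_swapOn μ s (fun p => ‖W p.1 - W (Function.update p.1 j (p.2 j))‖ₑ)
  simpa using key Finset.univ

/-- The case of a singleton in `measurePreserving_piecewise`, after forgetting the other coordinates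
of the second point. -/
lemma measurePreserving_update (μ : ι → Measure ℝ) [∀ i, IsProbabilityMeasure (μ i)] (j : ι) :
    MeasurePreserving (fun p : (ι → ℝ) × ℝ => Function.update p.1 j p.2)
      ((Measure.pi μ).prod (μ j)) (Measure.pi μ) := by
  have hq : MeasurePreserving (fun p : (ι → ℝ) × (ι → ℝ) => Function.update p.1 j (p.2 j))
      ((Measure.pi μ).prod (Measure.pi μ)) (Measure.pi μ) := by
    have := measurePreserving_piecewise μ {j}
    simpa [Finset.piecewise_singleton] using this
  have hev : MeasurePreserving (fun p : (ι → ℝ) × (ι → ℝ) => (p.1, p.2 j))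
      ((Measure.pi μ).prod (Measure.pi μ)) ((Measure.pi μ).prod (μ j)) :=
    (MeasurePreserving.id _).prod (measurePreserving_eval μ j)
  refine ⟨by fun_prop, ?_⟩
  rw [← hev.map_eq, Measure.map_map (by fun_prop) hev.measurable]
  exact hq.map_eq

lemma lintegral_update (μ : ι → Measure ℝ) [∀ i, IsProbabilityMeasure (μ i)] (j : ι)
    {f : (ι → ℝ) → ℝ≥0∞} (hf : AEMeasurable f (Measure.pi μ)) :
    ∫⁻ x, ∫⁻ t, f (Function.update x j t) ∂(μ j) ∂(Measure.pi μ) = ∫⁻ x, f x ∂(Measure.pi μ) := by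
  have hu := measurePreserving_update μ j
  rw [lintegral_lintegral (f := fun x t => f (Function.update x j t))
    (hf.comp_quasiMeasurePreserving hu.quasiMeasurePreserving)]
  conv_rhs => rw [← hu.map_eq]
  rw [lintegral_map' (by rwa [hu.map_eq]) hu.measurable.aemeasurable]

/-- Resampling one coordinate does not change the law of the point, so bounds by integrals along
lines average to integrals over the whole product. -/
lemma lintegral_sub_le_of_acl (μ : ι → Measure ℝ) [∀ i, IsProbabilityMeasure (μ i)]
    (C : ℝ≥0∞) {W : (ι → ℝ) → ℝ} (hW : AEMeasurable W (Measure.pi μ))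
    {G : ι → (ι → ℝ) → ℝ≥0∞} (hG : ∀ j, AEMeasurable (G j) (Measure.pi μ))
    (h : ∀ j, ∀ᵐ x ∂(Measure.pi μ), ∀ᵐ t ∂(μ j),
      ‖W x - W (Function.update x j t)‖ₑ ≤ C * ∫⁻ τ, G j (Function.update x j τ) ∂(μ j)) :
    ∫⁻ p, ‖W p.1 - W p.2‖ₑ ∂((Measure.pi μ).prod (Measure.pi μ)) ≤
      C * ∑ j, ∫⁻ x, G j x ∂(Measure.pi μ) := by
  refine (lintegral_sub_le_sum_update μ hW).trans ?_
  rw [Finset.mul_sum]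
  refine Finset.sum_le_sum fun j _ => ?_
  refine (lintegral_prod_le _).trans ?_
  calc ∫⁻ x, ∫⁻ y, ‖W x - W (Function.update x j (y j))‖ₑ ∂(Measure.pi μ) ∂(Measure.pi μ)
      ≤ ∫⁻ x, C * ∫⁻ τ, G j (Function.update x j τ) ∂(μ j) ∂(Measure.pi μ) := by
        refine lintegral_mono_ae ?_
        filter_upwards [h j] with x hx
        have := (measurePreserving_eval μ j).quasiMeasurePreserving.ae hx
        refine (lintegral_mono_ae this).trans ?_
        simp
    _ ≤ C * ∫⁻ x, G j x ∂(Measure.pi μ) := by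
        rw [← lintegral_update μ j (hG j)]
        refine le_of_eq (lintegral_const_mul'' _ ?_)
        have hq := measurePreserving_update μ j
        exact ((hG j).comp_quasiMeasurePreserving hq.quasiMeasurePreserving).lintegral_prod_right'

end Poincare

/-! ### Cubes, and functions absolutely continuous on lines -/

lemma pi_smul_restrict {d : ℕ} (c : ℝ≥0∞) (hc : c ≠ ∞) (I : Fin d → Set ℝ) :
    Measure.pi (fun i => c • (volume : Measure ℝ).restrict (I i)) =
      c ^ d • (volume : Measure (Fin d → ℝ)).restrict (univ.pi I) := by
  have : ∀ i, SigmaFinite (c • (volume : Measure ℝ).restrict (I i)) := fun i => by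
    lift c to NNReal using hc
    change SigmaFinite (c • (volume : Measure ℝ).restrict (I i))
    infer_instance
  refine Measure.pi_eq fun t ht => ?_
  rw [volume_pi, Measure.restrict_pi_pi]
  simp [Finset.prod_mul_distrib]

lemma enorm_sub_le_lintegral_deriv {F : ℝ → ℝ} {A B : ℝ}
    (hF : AbsolutelyContinuousOnInterval F A B) (hAB : A ≤ B) (g : ℝ) {u v : ℝ}
    (hu : u ∈ Icc A B) (hv : v ∈ Icc A B) :
    ‖(F u - g * u) - (F v - g * v)‖ₑ ≤ ∫⁻ τ in Icc A B, ‖deriv F τ - g‖ₑ := by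
  have hsub : uIcc v u ⊆ uIcc A B := by
    rw [uIcc_of_le hAB]
    exact uIcc_subset_Icc hv hu
  have hF' := hF.mono hsub
  have h1 : ∫ τ in v..u, (deriv F τ - g) = (F u - g * u) - (F v - g * v) := by
    rw [intervalIntegral.integral_sub hF'.intervalIntegrable_deriv (by simp),
      hF'.integral_deriv_eq_sub]
    simp
    ring
  rw [← h1, intervalIntegral.intervalIntegral_eq_integral_uIoc]
  rw [enorm_smul]
  have : ‖(if v ≤ u then (1 : ℝ) else -1)‖ₑ = 1 := by split_ifs <;> simp
  rw [this, one_mul]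
  refine (enorm_integral_le_lintegral_enorm _).trans ?_
  refine lintegral_mono_set ?_
  exact uIoc_subset_uIcc.trans (uIcc_subset_Icc hv hu)

/-- The closed cube of centre `a` and side `2 s`. -/
def cube {d : ℕ} (a : Eucl d) (s : ℝ) : Set (Eucl d) :=
  {x | ∀ i, x i ∈ Icc (a i - s) (a i + s)}

lemma isClosed_cube {d : ℕ} (a : Eucl d) (s : ℝ) : IsClosed (cube a s) := by
  have : cube a s = ⋂ i, (fun x : Eucl d => x i) ⁻¹' Icc (a i - s) (a i + s) := by
    ext x; simp [cube]
  rw [this]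
  exact isClosed_iInter fun i => isClosed_Icc.preimage (by fun_prop)

lemma closedBall_subset_cube {d : ℕ} (a : Eucl d) (s : ℝ) : Metric.closedBall a s ⊆ cube a s := by
  intro x hx i
  have h1 : |x i - a i| ≤ s := by
    have := (PiLp.norm_apply_le (x - a) i).trans (mem_closedBall_iff_norm.1 hx)
    simpa using this
  rw [abs_le] at h1
  constructor <;> linarith [h1.1, h1.2]

lemma cube_subset_closedBall {d : ℕ} (hd : 1 ≤ d) (a : Eucl d) {s : ℝ} (hs : 0 ≤ s) :
    cube a s ⊆ Metric.closedBall a (d * s) := by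
  intro x hx
  have h1 : ∑ i, (x i - a i) ^ 2 ≤ (d * s) ^ 2 := by
    have hd' : (1 : ℝ) ≤ d := by exact_mod_cast hd
    calc ∑ i, (x i - a i) ^ 2 ≤ ∑ _i : Fin d, s ^ 2 := by
          refine Finset.sum_le_sum fun i _ => ?_
          have := hx i
          exact sq_le_sq' (by linarith [this.1]) (by linarith [this.2])
      _ = d * s ^ 2 := by simp
      _ ≤ (d * s) ^ 2 := by nlinarith [mul_nonneg (sub_nonneg.2 hd') (sq_nonneg s)]
  rw [Metric.mem_closedBall, EuclideanSpace.dist_eq]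
  refine Real.sqrt_le_iff.2 ⟨by positivity, ?_⟩
  simpa [Real.dist_eq, sq_abs] using h1

lemma isCompact_cube {d : ℕ} (a : Eucl d) (s : ℝ) : IsCompact (cube a s) := by
  rcases Nat.eq_zero_or_pos d with rfl | hd
  · exact (Set.subsingleton_of_subsingleton (s := cube a s)).isCompact
  rcases le_or_gt 0 s with hs | hs
  · exact (isCompact_closedBall a (d * s)).of_isClosed_subset (isClosed_cube a s)
      (cube_subset_closedBall hd a hs)
  · have : cube a s = ∅ := by
      ext x
      simp only [mem_empty_iff_false, iff_false]
      intro hx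
      have := hx ⟨0, hd⟩
      linarith [this.1, this.2]
    simp [this]

lemma preimage_toLp_cube {d : ℕ} (a : Eucl d) (s : ℝ) :
    (WithLp.toLp 2 : (Fin d → ℝ) → Eucl d) ⁻¹' cube a s =
      univ.pi fun i => Icc (a i - s) (a i + s) := by
  ext x; simp only [cube, mem_preimage, mem_ofPred_eq, mem_univ_pi]

lemma toLp_update {d : ℕ} (x : Fin d → ℝ) (j : Fin d) (t : ℝ) :
    (WithLp.toLp 2 (Function.update x j t) : Eucl d) =
      WithLp.toLp 2 x + (t - x j) • EuclideanSpace.single j (1 : ℝ) := by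
  ext i
  by_cases h : i = j
  · subst h; simp
  · simp [h]

/-- The fundamental theorem of calculus along the chord of the cube through `x` in direction `j`,
applied to `Z` minus a linear function of slope `g`. -/
lemma acl_estimate {d : ℕ} {Ω : Set (Eucl d)} {Z : Eucl d → ℝ} {a : Eucl d} {s : ℝ}
    (hs : 0 ≤ s) (hQ : cube a s ⊆ Ω) (g : ℝ) (j : Fin d) {x : Fin d → ℝ}
    (hx : x ∈ univ.pi fun i => Icc (a i - s) (a i + s))
    (hac : ∀ A B : ℝ, A ≤ B →
      (∀ t ∈ Icc A B, WithLp.toLp 2 x + t • EuclideanSpace.single j (1 : ℝ) ∈ Ω) →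
      AbsolutelyContinuousOnInterval
        (fun t : ℝ => Z (WithLp.toLp 2 x + t • EuclideanSpace.single j (1 : ℝ))) A B)
    {t : ℝ} (ht : t ∈ Icc (a j - s) (a j + s)) :
    ‖(Z (WithLp.toLp 2 x) - g * x j) - (Z (WithLp.toLp 2 (Function.update x j t)) - g * t)‖ₑ ≤
      ∫⁻ τ in Icc (a j - s) (a j + s),
        ‖lineDeriv ℝ Z (WithLp.toLp 2 (Function.update x j τ)) (EuclideanSpace.single j 1) - g‖ₑ := by
  -- The chord is parametrized from `x`, so its ends are shifted by `x j`.
  set A := a j - s - x j with hA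
  set B := a j + s - x j with hB
  have hxj := hx j (mem_univ j)
  simp only [mem_Icc] at hxj
  have hAB : A ≤ B := by linarith
  have hF := hac A B hAB (fun τ hτ => hQ (by
    intro i
    have := hx i (mem_univ i)
    simp only [mem_Icc] at this hτ ⊢
    by_cases h : i = j
    · subst h; simp; constructor <;> linarith [hτ.1, hτ.2]
    · simpa [h] using this))
  have key := enorm_sub_le_lintegral_deriv hF hAB g (u := 0) (v := t - x j)
    ⟨by linarith, by linarith⟩ ⟨by linarith [ht.1], by linarith [ht.2]⟩
  have e1 : (Z (WithLp.toLp 2 x) - g * x j) - (Z (WithLp.toLp 2 (Function.update x j t)) - g * t) =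
      (Z (WithLp.toLp 2 x + (0 : ℝ) • EuclideanSpace.single j (1 : ℝ)) - g * 0) -
      (Z (WithLp.toLp 2 x + (t - x j) • EuclideanSpace.single j (1 : ℝ)) - g * (t - x j)) := by
    rw [toLp_update]; simp; ring
  rw [e1]
  refine key.trans (le_of_eq ?_)
  have hmp : MeasurePreserving (fun τ : ℝ => τ - x j) := measurePreserving_sub_right volume (x j)
  have hpre : (fun τ : ℝ => τ - x j) ⁻¹' Icc A B = Icc (a j - s) (a j + s) := by
    ext τ; simp [A, B]
  rw [← hpre, ← hmp.setLIntegral_comp_preimage_emb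
    (MeasurableEquiv.subRight (x j)).measurableEmbedding (fun τ => ‖deriv (fun t : ℝ =>
    Z (WithLp.toLp 2 x + t • EuclideanSpace.single j (1 : ℝ))) τ - g‖ₑ)]
  refine lintegral_congr fun τ => ?_
  rw [toLp_update, lineDeriv]
  congr 2
  have := deriv_comp_const_add (f := fun t : ℝ =>
    Z (WithLp.toLp 2 x + t • EuclideanSpace.single j (1 : ℝ))) (τ - x j) 0
  rw [add_zero] at this
  rw [← this]
  simp only [add_smul, add_assoc]

/-- `L¹` Poincaré inequality, on a cube, for functions that are absolutely continuous on lines. -/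
lemma exists_lintegral_sub_affine_le {d : ℕ} {Ω : Set (Eucl d)} {Z : Eucl d → ℝ}
    (hZ : IsAbsolutelyContinuousOn Z Ω) {a : Eucl d} {s : ℝ} (hs : 0 < s) (hQ : cube a s ⊆ Ω)
    (g : Eucl d) :
    ∃ m : ℝ, ∫⁻ x in cube a s, ‖Z x - inner ℝ g x - m‖ₑ ≤
      ENNReal.ofReal (2 * s) * ∑ j, ∫⁻ x in cube a s,
        ‖lineDeriv ℝ Z x (EuclideanSpace.single j 1) - g j‖ₑ := by
  set I : Fin d → Set ℝ := fun i => Icc (a i - s) (a i + s) with hI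
  -- Normalizes Lebesgue measure on each edge to a probability measure. The factor `2 * s` of the
  -- conclusion undoes this for the one integral along a line.
  set c : ℝ≥0∞ := (ENNReal.ofReal (2 * s))⁻¹ with hc
  have h2s : ENNReal.ofReal (2 * s) ≠ 0 := by
    rw [Ne, ENNReal.ofReal_eq_zero]; linarith
  have hc0 : c ≠ 0 := ENNReal.inv_ne_zero.2 ENNReal.ofReal_ne_top
  have hct : c ≠ ∞ := ENNReal.inv_ne_top.2 h2s
  set μ : Fin d → Measure ℝ := fun i => c • (volume : Measure ℝ).restrict (I i) with hμ
  have hprob : ∀ i, IsProbabilityMeasure (μ i) := fun i => ⟨by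
    simp only [hμ, hI, Measure.smul_apply, Measure.restrict_apply_univ, Real.volume_Icc, smul_eq_mul]
    rw [show a i + s - (a i - s) = 2 * s by ring]
    exact ENNReal.inv_mul_cancel h2s ENNReal.ofReal_ne_top⟩
  have hπ : Measure.pi μ = c ^ d • (volume : Measure (Fin d → ℝ)).restrict (univ.pi I) :=
    pi_smul_restrict c hct I
  have hcd0 : c ^ d ≠ 0 := pow_ne_zero _ hc0
  have hcdt : c ^ d ≠ ∞ := ENNReal.pow_ne_top hct
  have hmp : MeasurePreserving (WithLp.toLp 2 : (Fin d → ℝ) → Eucl d)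
      (volume.restrict (univ.pi I)) (volume.restrict (cube a s)) := by
    rw [← preimage_toLp_cube]
    exact (PiLp.volume_preserving_toLp (Fin d)).restrict_preimage (isClosed_cube a s).measurableSet
  have hemb : MeasurableEmbedding (WithLp.toLp 2 : (Fin d → ℝ) → Eucl d) :=
    (MeasurableEquiv.toLp 2 (Fin d → ℝ)).measurableEmbedding
  have hint : ∀ f : Eucl d → ℝ≥0∞, ∫⁻ x, f (WithLp.toLp 2 x) ∂(Measure.pi μ) =
      c ^ d * ∫⁻ x in cube a s, f x := by
    intro f
    rw [hπ, lintegral_smul_measure, hmp.lintegral_comp_emb hemb, smul_eq_mul]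
  have haem : ∀ f : Eucl d → ℝ, AEMeasurable f (volume.restrict (cube a s)) →
      AEMeasurable (fun x => f (WithLp.toLp 2 x)) (Measure.pi μ) := by
    intro f hf
    rw [hπ]
    exact (hf.comp_quasiMeasurePreserving hmp.quasiMeasurePreserving).smul_measure _
  have hZm : AEMeasurable (fun x => Z x - inner ℝ g x) (volume.restrict (cube a s)) :=
    ((hZ.continuousOn.mono hQ).aemeasurable (isClosed_cube a s).measurableSet).sub
      (by fun_prop)
  have hcomp : IsCompact (cube a s) := isCompact_cube a s
  have hGm : ∀ j, AEMeasurable (fun x => lineDeriv ℝ Z x (EuclideanSpace.single j 1) - g j)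
      (volume.restrict (cube a s)) := fun j =>
    (((hZ.locallyIntegrable j).mono_set hQ).integrableOn_isCompact hcomp).aemeasurable.sub
      aemeasurable_const
  have main := lintegral_sub_le_of_acl μ (ENNReal.ofReal (2 * s)) (haem _ hZm)
    (G := fun j x => ‖lineDeriv ℝ Z (WithLp.toLp 2 x) (EuclideanSpace.single j 1) - g j‖ₑ)
    (fun j => (haem _ (hGm j)).enorm) (by
      intro j
      have hac : ∀ᵐ x : Fin d → ℝ, ∀ A B : ℝ, A ≤ B →
        (∀ t ∈ Icc A B, WithLp.toLp 2 x + t • EuclideanSpace.single j (1 : ℝ) ∈ Ω) →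
        AbsolutelyContinuousOnInterval
          (fun t : ℝ => Z (WithLp.toLp 2 x + t • EuclideanSpace.single j (1 : ℝ))) A B :=
        (PiLp.volume_preserving_toLp (Fin d)).quasiMeasurePreserving.ae (hZ.acOnLines j)
      have hac' : ∀ᵐ x ∂(Measure.pi μ), x ∈ univ.pi I ∧ ∀ A B : ℝ, A ≤ B →
        (∀ t ∈ Icc A B, WithLp.toLp 2 x + t • EuclideanSpace.single j (1 : ℝ) ∈ Ω) →
        AbsolutelyContinuousOnInterval
          (fun t : ℝ => Z (WithLp.toLp 2 x + t • EuclideanSpace.single j (1 : ℝ))) A B := by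
        rw [hπ]
        refine Measure.ae_smul_measure ?_ _
        have hmeas : MeasurableSet (univ.pi I) := MeasurableSet.univ_pi fun i => measurableSet_Icc
        filter_upwards [ae_restrict_mem hmeas, ae_restrict_of_ae hac] with x h1 h2 using ⟨h1, h2⟩
      filter_upwards [hac'] with x hx
      refine Measure.ae_smul_measure ?_ _
      filter_upwards [ae_restrict_mem measurableSet_Icc] with t ht
      have h3 := acl_estimate hs.le hQ (g j) j hx.1 hx.2 ht
      have h4 : ∫⁻ τ, ‖lineDeriv ℝ Z (WithLp.toLp 2 (Function.update x j τ))
          (EuclideanSpace.single j 1) - g j‖ₑ ∂(μ j) = c * ∫⁻ τ in I j,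
          ‖lineDeriv ℝ Z (WithLp.toLp 2 (Function.update x j τ))
          (EuclideanSpace.single j 1) - g j‖ₑ := by
        rw [lintegral_smul_measure, smul_eq_mul]
      rw [h4, ← mul_assoc, ENNReal.mul_inv_cancel h2s ENNReal.ofReal_ne_top, one_mul]
      refine le_trans (le_of_eq ?_) h3
      congr 1
      rw [toLp_update, inner_add_right, inner_smul_right]
      simp [EuclideanSpace.inner_single_right]
      ring)
  have hprodm : AEMeasurable (fun p : (Fin d → ℝ) × (Fin d → ℝ) =>
      ‖(Z (WithLp.toLp 2 p.1) - inner ℝ g (WithLp.toLp 2 p.1)) -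
        (Z (WithLp.toLp 2 p.2) - inner ℝ g (WithLp.toLp 2 p.2))‖ₑ)
      ((Measure.pi μ).prod (Measure.pi μ)) :=
    (((haem _ hZm).comp_quasiMeasurePreserving
      measurePreserving_fst.quasiMeasurePreserving).sub ((haem _ hZm).comp_quasiMeasurePreserving
      measurePreserving_snd.quasiMeasurePreserving)).enorm
  rw [lintegral_prod_symm _ hprodm] at main
  -- Some `y` does no worse than the average over the second point. The value of `Z - inner g` at
  -- this `y` serves as the constant `m`.
  obtain ⟨y, hy⟩ := exists_le_lintegral (μ := Measure.pi μ) hprodm.lintegral_prod_left'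
  refine ⟨Z (WithLp.toLp 2 y) - inner ℝ g (WithLp.toLp 2 y), ?_⟩
  have h5 := hy.trans main
  rw [hint (fun x => ‖(Z x - inner ℝ g x) -
    (Z (WithLp.toLp 2 y) - inner ℝ g (WithLp.toLp 2 y))‖ₑ)] at h5
  simp_rw [fun j => hint (fun x => ‖lineDeriv ℝ Z x (EuclideanSpace.single j 1) - g j‖ₑ)] at h5
  rw [← Finset.mul_sum, mul_left_comm] at h5
  exact (ENNReal.mul_le_mul_iff_right hcd0 hcdt).1 h5

/-! ### A point of nonzero differential -/

/-- The Poincaré inequality with slope `0` makes `Z` almost everywhere equal to a constant on a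
smaller ball, and continuity removes the exceptional set. -/
lemma eqOn_ball_of_lineDeriv_eq_zero {d : ℕ} (hd : 1 ≤ d) {Ω : Set (Eucl d)} {Z : Eucl d → ℝ}
    (hZ : IsAbsolutelyContinuousOn Z Ω) {a : Eucl d} {R : ℝ} (hR : 0 < R)
    (hball : Metric.ball a R ⊆ Ω)
    (h0 : ∀ᵐ x ∂(volume.restrict (Metric.ball a R)),
      ∀ j, lineDeriv ℝ Z x (EuclideanSpace.single j 1) = 0) :
    ∃ s, 0 < s ∧ ∀ x ∈ Metric.ball a s, Z x = Z a := by
  have hd0 : (0 : ℝ) < d := by exact_mod_cast hd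
  set s := R / (2 * d) with hs
  have hs0 : 0 < s := by positivity
  have hds : d * s < R := by
    rw [hs]; field_simp; linarith
  have hcb : cube a s ⊆ Metric.ball a R :=
    (cube_subset_closedBall hd a hs0.le).trans (Metric.closedBall_subset_ball hds)
  have hbc : Metric.ball a s ⊆ cube a s :=
    Metric.ball_subset_closedBall.trans (closedBall_subset_cube a s)
  obtain ⟨m, hm⟩ := exists_lintegral_sub_affine_le hZ hs0 (hcb.trans hball) 0
  have hz : ∑ j, ∫⁻ x in cube a s,
        ‖lineDeriv ℝ Z x (EuclideanSpace.single j 1) - (0 : Eucl d) j‖ₑ = 0 := by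
    refine Finset.sum_eq_zero fun j _ => ?_
    rw [← lintegral_zero (μ := volume.restrict (cube a s))]
    refine lintegral_congr_ae ?_
    filter_upwards [ae_restrict_of_ae_restrict_of_subset hcb h0] with x hx
    simp [hx j]
  rw [hz, mul_zero, nonpos_iff_eq_zero] at hm
  have hcont : ContinuousOn Z (Metric.ball a s) := hZ.continuousOn.mono ((hbc.trans hcb).trans hball)
  have hm' := le_antisymm ((lintegral_mono_set hbc).trans hm.le) bot_le
  rw [lintegral_eq_zero_iff'] at hm'
  · have heq : Z =ᵐ[volume.restrict (Metric.ball a s)] fun _ => m := by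
      filter_upwards [hm'] with x hx
      simpa [sub_eq_zero] using hx
    have := Measure.eqOn_open_of_ae_eq heq Metric.isOpen_ball hcont continuousOn_const
    refine ⟨s, hs0, fun x hx => ?_⟩
    rw [this hx, this (Metric.mem_ball_self hs0)]
  · refine AEMeasurable.enorm (((hcont.aemeasurable Metric.isOpen_ball.measurableSet).sub
      (by fun_prop)).sub aemeasurable_const)

/-- Otherwise `Z` would be locally constant on a connected set. -/
lemma exists_ball_lineDeriv_ne_zero {d : ℕ} (hd : 1 ≤ d) {Ω : Set (Eucl d)} (hΩ : IsOpen Ω)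
    (hconn : IsPreconnected Ω) {Z : Eucl d → ℝ} (hZ : IsAbsolutelyContinuousOn Z Ω)
    (hZne : ∃ x ∈ Ω, ∃ y ∈ Ω, Z x ≠ Z y) :
    ∃ a R, 0 < R ∧ Metric.closedBall a R ⊆ Ω ∧ ¬ ∀ᵐ x ∂(volume.restrict (Metric.ball a R)),
      ∀ j, lineDeriv ℝ Z x (EuclideanSpace.single j 1) = 0 := by
  by_contra! hcon
  obtain ⟨x, hx, y, hy, hxy⟩ := hZne
  apply hxy
  have : PreconnectedSpace Ω := isPreconnected_iff_preconnectedSpace.1 hconn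
  have hloc : IsLocallyConstant (Ω.domRestrict Z) := by
    rw [IsLocallyConstant.iff_eventually_eq]
    rintro ⟨a, ha⟩
    obtain ⟨R, hR, hRΩ⟩ := Metric.nhds_basis_closedBall.mem_iff.1 (hΩ.mem_nhds ha)
    obtain ⟨s, hs, hsa⟩ := eqOn_ball_of_lineDeriv_eq_zero hd hZ hR
      (Metric.ball_subset_closedBall.trans hRΩ) (hcon a R hR hRΩ)
    filter_upwards [continuous_subtype_val.continuousAt (Metric.ball_mem_nhds a hs)] with z hz
    exact hsa _ hz
  exact hloc.apply_eq_of_isPreconnected (s := univ) isPreconnected_univ (x := ⟨x, hx⟩)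
    (y := ⟨y, hy⟩) trivial trivial

/-- There is a point at which `Z` has a nonzero differential, in the `L¹` sense. -/
theorem exists_L1_differentiable_point {d : ℕ} (hd : 1 ≤ d) {Ω : Set (Eucl d)} (hΩ : IsOpen Ω)
    (hconn : IsPreconnected Ω) {Z : Eucl d → ℝ} (hZ : IsAbsolutelyContinuousOn Z Ω)
    (hZne : ∃ x ∈ Ω, ∃ y ∈ Ω, Z x ≠ Z y) :
    ∃ x₀ : Eucl d, ∃ g : Eucl d, g ≠ 0 ∧ ∀ η : ℝ, 0 < η → ∃ δ, 0 < δ ∧ ∀ s, 0 < s → s < δ →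
      Metric.closedBall x₀ s ⊆ Ω ∧ ∃ m : ℝ, ∫⁻ x in Metric.closedBall x₀ s,
        ‖Z x - inner ℝ g x - m‖ₑ ≤ ENNReal.ofReal (η * s ^ (d + 1)) := by
  obtain ⟨a, R, hR, hRΩ, hnz⟩ := exists_ball_lineDeriv_ne_zero hd hΩ hconn hZ hZne
  have hd0 : (0 : ℝ) < d := by exact_mod_cast hd
  -- Cutting off to a compact ball makes the partial derivatives integrable on the whole space, as
  -- the Lebesgue differentiation theorem is applied there.
  set f : Fin d → Eucl d → ℝ := fun j => (Metric.closedBall a R).indicator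
    (fun x => lineDeriv ℝ Z x (EuclideanSpace.single j 1)) with hf
  have hfint : ∀ j, Integrable (f j) := fun j =>
    (((hZ.locallyIntegrable j).mono_set hRΩ).integrableOn_isCompact
      (isCompact_closedBall a R)).integrable_indicator Metric.isClosed_closedBall.measurableSet
  have hleb : ∀ᵐ x, ∀ j, Tendsto (fun r => ⨍ y in Metric.closedBall x r, ‖f j y - f j x‖)
      (𝓝[>] 0) (𝓝 0) := by
    rw [ae_all_iff]
    intro j
    filter_upwards [IsUnifLocDoublingMeasure.ae_tendsto_average_norm_sub volume
      (hfint j).locallyIntegrable 1] with x hx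
    refine hx (fun _ => x) id tendsto_id ?_
    filter_upwards [self_mem_nhdsWithin] with r hr
    simp only [one_mul, id]
    exact Metric.mem_closedBall_self (le_of_lt hr)
  obtain ⟨x₀, hx₀R, hx₀, hx₀ne⟩ : ∃ x₀ ∈ Metric.ball a R,
      (∀ j, Tendsto (fun r => ⨍ y in Metric.closedBall x₀ r, ‖f j y - f j x₀‖) (𝓝[>] 0) (𝓝 0)) ∧
      ∃ j, lineDeriv ℝ Z x₀ (EuclideanSpace.single j 1) ≠ 0 := by
    by_contra! hcon
    apply hnz
    filter_upwards [ae_restrict_of_ae hleb, ae_restrict_mem measurableSet_ball] with x h1 h2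
    exact hcon x h2 h1
  set g : Eucl d := WithLp.toLp 2 fun j => lineDeriv ℝ Z x₀ (EuclideanSpace.single j 1) with hg
  refine ⟨x₀, g, ?_, ?_⟩
  · obtain ⟨j, hj⟩ := hx₀ne
    intro h
    apply hj
    have := congrArg (fun v : Eucl d => v j) h
    simpa [hg] using this
  intro η hη
  set V : ℝ := (volume : Measure (Eucl d)).real (Metric.closedBall 0 1) with hV
  have hV0 : 0 < V := by
    rw [hV, measureReal_def]
    exact ENNReal.toReal_pos (Metric.measure_closedBall_pos _ _ one_pos).ne'
      measure_closedBall_lt_top.ne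
  -- Solves `2 * s * d * (κ * ((d * s) ^ d * V)) = η * s ^ (d + 1)`, the bound that results from the
  -- Poincaré inequality.
  set κ : ℝ := η / (2 * d * (d ^ d * V)) with hκ
  have hκ0 : 0 < κ := by positivity
  obtain ⟨δ₁, hδ₁, hδ₁'⟩ : ∃ δ₁, 0 < δ₁ ∧ ∀ r, 0 < r → r < δ₁ → ∀ j,
      ⨍ y in Metric.closedBall x₀ r, ‖f j y - f j x₀‖ ≤ κ := by
    have h1 : ∀ᶠ r in 𝓝[>] (0 : ℝ), ∀ j, ⨍ y in Metric.closedBall x₀ r, ‖f j y - f j x₀‖ ≤ κ := by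
      rw [eventually_all]
      intro j
      exact (hx₀ j).eventually_le_const hκ0
    obtain ⟨δ₁, h2, h3⟩ := mem_nhdsGT_iff_exists_Ioo_subset.1 h1
    exact ⟨δ₁, h2, fun r hr hr' => h3 ⟨hr, hr'⟩⟩
  have hdist : 0 < R - dist x₀ a := by
    rw [Metric.mem_ball] at hx₀R; linarith
  -- The division by `d` is needed because the cube containing the ball of radius `s` is only known
  -- to lie in the ball of radius `d * s`.
  refine ⟨min (δ₁ / d) ((R - dist x₀ a) / d), by positivity, fun s hs hsδ => ?_⟩
  have hs1 : d * s < δ₁ := by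
    have := hsδ.trans_le (min_le_left _ _)
    rw [lt_div_iff₀ hd0] at this; linarith
  have hs2 : d * s < R - dist x₀ a := by
    have := hsδ.trans_le (min_le_right _ _)
    rw [lt_div_iff₀ hd0] at this; linarith
  have hdsR : Metric.closedBall x₀ (d * s) ⊆ Metric.closedBall a R :=
    Metric.closedBall_subset_closedBall' (by linarith)
  have hcb := cube_subset_closedBall hd x₀ hs.le
  have hbc := closedBall_subset_cube x₀ s
  refine ⟨(hbc.trans hcb).trans (hdsR.trans hRΩ), ?_⟩
  obtain ⟨m, hm⟩ := exists_lintegral_sub_affine_le hZ hs (hcb.trans (hdsR.trans hRΩ)) g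
  refine ⟨m, ((lintegral_mono_set hbc).trans hm).trans ?_⟩
  have hj : ∀ j, ∫⁻ x in cube x₀ s, ‖lineDeriv ℝ Z x (EuclideanSpace.single j 1) - g j‖ₑ ≤
      ENNReal.ofReal (κ * ((d * s) ^ d * V)) := by
    intro j
    refine (lintegral_mono_set hcb).trans ?_
    have e1 : ∫⁻ x in Metric.closedBall x₀ (d * s),
        ‖lineDeriv ℝ Z x (EuclideanSpace.single j 1) - g j‖ₑ =
        ∫⁻ x in Metric.closedBall x₀ (d * s), ‖f j x - f j x₀‖ₑ := by
      refine setLIntegral_congr_fun Metric.isClosed_closedBall.measurableSet fun x hx => ?_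
      simp only [hf]
      rw [indicator_of_mem (hdsR hx), indicator_of_mem (Metric.ball_subset_closedBall hx₀R)]
    have hii : IntegrableOn (fun x => f j x - f j x₀) (Metric.closedBall x₀ (d * s)) :=
      (hfint j).integrableOn.sub (integrableOn_const measure_closedBall_lt_top.ne)
    rw [e1, ← ofReal_integral_norm_eq_lintegral_enorm hii]
    apply ENNReal.ofReal_le_ofReal
    have e2 := hδ₁' (d * s) (by positivity) hs1 j
    have e3 : (volume : Measure (Eucl d)).real (Metric.closedBall x₀ (d * s)) = (d * s) ^ d * V := by
      rw [hV, measureReal_def, measureReal_def, Measure.addHaar_closedBall' _ _ (by positivity),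
        ENNReal.toReal_mul, ENNReal.toReal_ofReal (by positivity)]
      simp
    rw [setAverage_eq, smul_eq_mul, e3, inv_mul_le_iff₀ (by positivity)] at e2
    linarith
  calc ENNReal.ofReal (2 * s) * ∑ j, ∫⁻ x in cube x₀ s,
        ‖lineDeriv ℝ Z x (EuclideanSpace.single j 1) - g j‖ₑ
      ≤ ENNReal.ofReal (2 * s) * ∑ _j : Fin d, ENNReal.ofReal (κ * ((d * s) ^ d * V)) := by
        gcongr with j; exact hj j
    _ = ENNReal.ofReal (η * s ^ (d + 1)) := by
        rw [Finset.sum_const, Finset.card_univ, Fintype.card_fin, nsmul_eq_mul,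
          ← ENNReal.ofReal_natCast, ← ENNReal.ofReal_mul (by positivity),
          ← ENNReal.ofReal_mul (by positivity)]
        congr 1
        rw [hκ]
        field_simp
        rw [mul_pow]
        ring

/-! ### Enumerations of `ℕ^d` -/

/-- Neighbouring vertices of the grid `ℕ^d`. -/
def GridAdj {d : ℕ} (k m : Fin d → ℕ) : Prop :=
  ∃ i, (∀ j, j ≠ i → k j = m j) ∧ (k i + 1 = m i ∨ m i + 1 = k i)

/-- The position after `j` steps along the `N`-th square shell `max a b = N` of `ℕ × ℕ`,
alternately traversed in either direction. -/
def shellPoint (N j : ℕ) : ℕ × ℕ :=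
  if Even N then (if j ≤ N then (j, N) else (N, 2 * N - j))
  else (if j ≤ N then (N, j) else (2 * N - j, N))

/-- The path through `ℕ × ℕ` which runs through the square shells one after another. -/
def snake (n : ℕ) : ℕ × ℕ := shellPoint n.sqrt (n - n.sqrt * n.sqrt)

lemma snake_add {N j : ℕ} (hj : j ≤ 2 * N) : snake (N * N + j) = shellPoint N j := by
  have : (N * N + j).sqrt = N := Nat.sqrt_add_eq N (by omega)
  simp [snake, this]

lemma exists_eq_sq_add (n : ℕ) : ∃ N j, j ≤ 2 * N ∧ n = N * N + j :=
  ⟨n.sqrt, n - n.sqrt * n.sqrt, by have := Nat.sqrt_le_add n; omega,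
    by have := Nat.sqrt_le n; omega⟩

/-- Recovers the shell from the point, so that injectivity of `snake` is a question about one shell.
-/
lemma max_shellPoint {N j : ℕ} (hj : j ≤ 2 * N) :
    max (shellPoint N j).1 (shellPoint N j).2 = N := by
  unfold shellPoint
  split_ifs <;> simp <;> omega

lemma snake_injective : Function.Injective snake := by
  intro n m h
  obtain ⟨N, j, hj, rfl⟩ := exists_eq_sq_add n
  obtain ⟨M, i, hi, rfl⟩ := exists_eq_sq_add m
  rw [snake_add hj, snake_add hi] at h
  have hNM : N = M := by rw [← max_shellPoint hj, ← max_shellPoint hi, h]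
  subst hNM
  have : j = i := by
    unfold shellPoint at h
    split_ifs at h <;> simp only [Prod.mk.injEq] at h <;> omega
  rw [this]

lemma snake_surjective : Function.Surjective snake := by
  rintro ⟨a, b⟩
  suffices ∃ N j, j ≤ 2 * N ∧ shellPoint N j = (a, b) by
    obtain ⟨N, j, hj, h⟩ := this
    exact ⟨N * N + j, by rw [snake_add hj, h]⟩
  rcases le_total a b with hab | hab
  · by_cases hb : Even b
    · exact ⟨b, a, by omega, by simp [shellPoint, hb, hab]⟩
    · refine ⟨b, 2 * b - a, by omega, ?_⟩
      simp only [shellPoint, hb, if_false]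
      split_ifs <;> ext <;> simp <;> omega
  · by_cases ha : Even a
    · refine ⟨a, 2 * a - b, by omega, ?_⟩
      simp only [shellPoint, ha, if_true]
      split_ifs <;> ext <;> simp <;> omega
    · exact ⟨a, b, by omega, by simp [shellPoint, ha, hab]⟩

lemma snake_succ (n : ℕ) :
    ((snake n).1 = (snake (n + 1)).1 ∧
      ((snake n).2 + 1 = (snake (n + 1)).2 ∨ (snake (n + 1)).2 + 1 = (snake n).2)) ∨
    ((snake n).2 = (snake (n + 1)).2 ∧
      ((snake n).1 + 1 = (snake (n + 1)).1 ∨ (snake (n + 1)).1 + 1 = (snake n).1)) := by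
  obtain ⟨N, j, hj, rfl⟩ := exists_eq_sq_add n
  rcases hj.lt_or_eq with h | rfl
  · rw [snake_add hj, add_assoc, snake_add (by omega)]
    unfold shellPoint
    split_ifs <;> simp <;> omega
  -- The alternation of directions pays off here: shell `N` ends at `(N, 0)` for even `N` and at
  -- `(0, N)` for odd `N`, and the next shell starts one unit further out on the same axis.
  · have e : N * N + 2 * N + 1 = (N + 1) * (N + 1) + 0 := by ring
    rw [snake_add hj, e, snake_add (by omega)]
    unfold shellPoint
    by_cases hN : Even N <;> simp [hN, Nat.even_add_one] <;> split_ifs <;> simp <;> omega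

/-- Induction on the dimension: a path `p` through the last coordinates identifies the grid with `ℕ
× ℕ`, which `snake` traverses. A unit step in the second factor is one step along `p`, forwards or
backwards, hence again a step in the grid. -/
theorem exists_grid_path (d : ℕ) :
    ∃ p : ℕ ≃ (Fin (d + 1) → ℕ), ∀ l, GridAdj (p l) (p (l + 1)) := by
  induction d with
  | zero =>
    refine ⟨(Equiv.funUnique (Fin 1) ℕ).symm, fun l => ⟨0, fun j hj => ?_, ?_⟩⟩
    · exact absurd (Fin.fin_one_eq_zero j) hj
    · simp
  | succ d ih =>
    obtain ⟨p, hp⟩ := ih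
    set q := (Equiv.ofBijective snake ⟨snake_injective, snake_surjective⟩).trans
      (((Equiv.refl ℕ).prodCongr p).trans (Fin.consEquiv fun _ => ℕ)) with hq
    have hq' : ∀ l, q l = Fin.cons (snake l).1 (p (snake l).2) := fun l => rfl
    refine ⟨q, fun l => ?_⟩
    rw [hq', hq']
    have hadj : ∀ a b, (a + 1 = b ∨ b + 1 = a) → GridAdj (p a) (p b) := by
      rintro a b (rfl | rfl)
      · exact hp a
      · obtain ⟨i, h1, h2⟩ := hp b
        exact ⟨i, fun j hj => (h1 j hj).symm, h2.symm⟩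
    rcases snake_succ l with ⟨h1, h2⟩ | ⟨h1, h2⟩
    · obtain ⟨i, h3, h4⟩ := hadj _ _ h2
      refine ⟨i.succ, fun j hj => ?_, ?_⟩
      · refine Fin.cases ?_ (fun j hj => ?_) j hj
        · intro _
          simpa using h1
        · simpa using h3 j (fun h => hj (by rw [h]))
      · simpa using h4
    · refine ⟨0, fun j hj => ?_, ?_⟩
      · refine Fin.cases (fun h => absurd rfl h) (fun j _ => ?_) j hj
        simp [h1]
      · simpa using h2

/-- Enumeration, in increasing order, of a family with finite sublevel sets. -/
theorem exists_equiv_nat_strictMono {K : Type*} [Infinite K] (μ : K → ℝ)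
    (hinj : Function.Injective μ) (hfin : ∀ M, {k | μ k ≤ M}.Finite) :
    ∃ e : ℕ ≃ K, StrictMono (μ ∘ e) := by
  have hlt : ∀ k, {m | μ m < μ k}.Finite := fun k => (hfin (μ k)).subset fun m (hm : μ m < μ k) => hm.le
  -- The rank of `k`. It turns out to be a bijection onto `ℕ`, whose inverse is the enumeration.
  set N : K → ℕ := fun k => {m | μ m < μ k}.ncard with hN
  have hmono : ∀ k m, μ k < μ m → N k < N m := by
    intro k m h
    refine Set.ncard_lt_ncard ?_ (hlt m)
    refine ⟨fun x hx => lt_trans hx h, fun hsub => ?_⟩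
    exact lt_irrefl (μ k) (hsub h)
  have hNinj : Function.Injective N := by
    intro k m h
    rcases lt_trichotomy (μ k) (μ m) with h1 | h1 | h1
    · exact absurd h (hmono _ _ h1).ne
    · exact hinj h1
    · exact absurd h (hmono _ _ h1).ne'
  -- The largest element below `k` has rank one less. Hence the set of ranks is closed downwards,
  -- and being infinite it is all of `ℕ`.
  have hlow : ∀ k n, N k = n + 1 → ∃ m, N m = n := by
    intro k n h
    have hne : {m | μ m < μ k}.Nonempty := by
      apply Set.nonempty_of_ncard_ne_zero
      change N k ≠ 0
      omega
    obtain ⟨m, hm, hmax⟩ := Set.exists_max_image _ μ (hlt k) hne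
    refine ⟨m, ?_⟩
    have : {x | μ x < μ k} = insert m {x | μ x < μ m} := by
      ext x
      simp only [mem_ofPred_eq, mem_insert_iff]
      constructor
      · intro hx
        rcases (hmax x hx).lt_or_eq with h1 | h1
        · exact Or.inr h1
        · exact Or.inl (hinj h1)
      · rintro (rfl | hx)
        · exact hm
        · exact lt_trans hx hm
    have h2 : N k = N m + 1 := by
      simp only [hN]
      rw [this, Set.ncard_insert_of_notMem (by simp) (hlt m)]
    omega
  have hlow' : ∀ j n, (∃ k, N k = n + j) → ∃ m, N m = n := by
    intro j
    induction j with
    | zero => intro n h; exact h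
    | succ j ih =>
      rintro n ⟨k, hk⟩
      exact ih n (hlow k (n + j) hk)
  have hsurj : Function.Surjective N := by
    intro n
    obtain ⟨x, ⟨k, rfl⟩, hk⟩ := (Set.infinite_range_of_injective hNinj).exists_gt n
    exact hlow' (N k - n) n ⟨k, by omega⟩
  set e := (Equiv.ofBijective N ⟨hNinj, hsurj⟩).symm with he
  have hNe : ∀ n, N (e n) = n := fun n => Equiv.apply_symm_apply (Equiv.ofBijective N _) n
  refine ⟨e, fun a b hab => ?_⟩
  by_contra! hle
  have : N (e b) ≤ N (e a) := by
    rcases hle.lt_or_eq with h | h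
    · exact (hmono _ _ h).le
    · rw [hinj h]
  rw [hNe, hNe] at this
  omega

/-- The two enumerations differ by an order automorphism of `ℕ`, which is the identity. -/
lemma strictMono_equiv_unique {K : Type*} {μ : K → ℝ} {e σ : ℕ ≃ K} (he : StrictMono (μ ∘ e))
    (hσ : Monotone (μ ∘ σ)) : σ = e := by
  have hm : Monotone (σ.trans e.symm) := by
    intro a b hab
    have := hσ hab
    simp only [Function.comp] at this
    rw [← he.le_iff_le]
    simpa using this
  have hs : StrictMono (σ.trans e.symm) := hm.strictMono_of_injective (Equiv.injective _)
  have hid : ∀ n, (σ.trans e.symm) n = n := by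
    have := (hs.orderIsoOfSurjective _ (Equiv.surjective _))
    have h2 : hs.orderIsoOfSurjective _ (Equiv.surjective _) = OrderIso.refl ℕ :=
      Subsingleton.elim _ _
    intro n
    exact congrArg (fun f : ℕ ≃o ℕ => f n) h2
  ext n
  have := hid n
  simp only [Equiv.trans_apply, Equiv.symm_apply_eq] at this
  exact this

/-! ### Side lengths giving a simple spectrum -/

/-- With sides `|t|⁻ⁱ`, a coincidence of two values is an integer polynomial relation for `t`. If
`t` is transcendental, all coefficients `(k i + 1)² - (m i + 1)²` vanish. Only even powers of `t`
occur, so the absolute value is harmless. -/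
theorem exists_sides_injective (d : ℕ) : ∃ ρ : Fin d → ℝ, (∀ i, 0 < ρ i) ∧
    Function.Injective fun k : Fin d → ℕ => ∑ i, (((k i : ℝ) + 1) / ρ i) ^ 2 := by
  set t := liouvilleNumber 2 with ht
  have htr : Transcendental ℤ t := transcendental_liouvilleNumber le_rfl
  have ht0 : t ≠ 0 := by
    rintro h
    exact htr (by rw [h]; exact isAlgebraic_zero)
  refine ⟨fun i => (|t| ^ (i : ℕ))⁻¹, fun i => by positivity, fun k m hkm => ?_⟩
  have hkm : ∑ i : Fin d, (((k i : ℝ) + 1) / (|t| ^ (i : ℕ))⁻¹) ^ 2 =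
      ∑ i : Fin d, (((m i : ℝ) + 1) / (|t| ^ (i : ℕ))⁻¹) ^ 2 := hkm
  set P : Polynomial ℤ := ∑ i : Fin d,
    Polynomial.monomial (2 * (i : ℕ)) ((((k i : ℤ) + 1) ^ 2 - ((m i : ℤ) + 1) ^ 2)) with hP
  have hPt : Polynomial.aeval t P = 0 := by
    rw [hP, map_sum]
    simp only [Polynomial.aeval_monomial]
    rw [← sub_eq_zero, ← Finset.sum_sub_distrib] at hkm
    rw [← hkm]
    refine Finset.sum_congr rfl fun i _ => ?_
    have : t ^ (2 * (i : ℕ)) = (|t| ^ (i : ℕ)) ^ 2 := by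
      rw [← pow_mul, mul_comm _ 2, pow_mul, pow_mul, sq_abs]
    rw [this]
    simp only [div_inv_eq_mul, mul_pow]
    push_cast
    ring
  have hP0 : P = 0 := by
    by_contra hne
    exact htr ⟨P, hne, hPt⟩
  funext i
  have hc : P.coeff (2 * (i : ℕ)) = 0 := by rw [hP0]; simp
  rw [hP, Polynomial.finsetSum_coeff] at hc
  simp only [Polynomial.coeff_monomial] at hc
  rw [Finset.sum_eq_single i] at hc
  · simp only [if_true] at hc
    have h1 : ((k i : ℤ) + 1) ^ 2 = ((m i : ℤ) + 1) ^ 2 := by linarith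
    have h2 := (pow_left_inj₀ (by positivity) (by positivity) two_ne_zero).1 h1
    omega
  · intro j _ hj
    rw [if_neg]
    intro h
    exact hj (Fin.ext (by omega))
  · simp

/-! ### Orthotopes -/

section Box

variable {d : ℕ}

/-- The open orthotope with vertex `c` and sides `r i` along `b i`. -/
def box (b : OrthonormalBasis (Fin d) ℝ (Eucl d)) (c : Eucl d) (r : Fin d → ℝ) : Set (Eucl d) :=
  {x | ∀ i, inner ℝ (b i) (x - c) ∈ Ioo 0 (r i)}

variable (b : OrthonormalBasis (Fin d) ℝ (Eucl d)) (c : Eucl d) {r : Fin d → ℝ}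

lemma isOpen_box : IsOpen (box b c r) := by
  have : box b c r = ⋂ i, (fun x : Eucl d => inner ℝ (b i) (x - c)) ⁻¹' Ioo 0 (r i) := by
    ext x; simp [box]
  rw [this]
  exact isOpen_iInter_of_finite fun i => isOpen_Ioo.preimage (by fun_prop)

lemma closure_box_subset :
    closure (box b c r) ⊆ {x | ∀ i, inner ℝ (b i) (x - c) ∈ Icc 0 (r i)} := by
  have : {x | ∀ i, inner ℝ (b i) (x - c) ∈ Icc 0 (r i)} =
      ⋂ i, (fun x : Eucl d => inner ℝ (b i) (x - c)) ⁻¹' Icc 0 (r i) := by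
    ext x; simp
  refine closure_minimal (fun x hx i => Ioo_subset_Icc_self (hx i)) ?_
  rw [this]
  exact isClosed_iInter fun i => isClosed_Icc.preimage (by fun_prop)

lemma closedBox_subset_closedBall {R : ℝ} (hR : 0 ≤ R) (hr : ∑ i, r i ^ 2 ≤ R ^ 2) :
    {x | ∀ i, inner ℝ (b i) (x - c) ∈ Icc 0 (r i)} ⊆ Metric.closedBall c R := by
  intro x hx
  rw [mem_closedBall_iff_norm]
  refine le_of_sq_le_sq ?_ hR
  rw [← b.sum_sq_norm_inner_right (x - c)]
  refine le_trans (Finset.sum_le_sum fun i _ => ?_) hr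
  rw [Real.norm_eq_abs, sq_abs]
  exact pow_le_pow_left₀ (hx i).1 (hx i).2 2

lemma isBounded_box : Bornology.IsBounded (box b c r) := by
  have h : 0 ≤ ∑ i, r i ^ 2 := Finset.sum_nonneg fun i _ => sq_nonneg _
  refine Metric.isBounded_closedBall.subset ((subset_closure.trans (closure_box_subset b c)).trans
    (closedBox_subset_closedBall b c (Real.sqrt_nonneg _) (Real.sq_sqrt h).ge))

lemma convex_box : Convex ℝ (box b c r) := by
  intro x hx y hy s t hs ht hst i
  have : inner ℝ (b i) (s • x + t • y - c) =
      s • inner ℝ (b i) (x - c) + t • inner ℝ (b i) (y - c) := by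
    simp only [inner_sub_right, inner_add_right, inner_smul_right, smul_eq_mul]
    linear_combination (inner ℝ (b i) c) * hst
  rw [this]
  exact convex_Ioo 0 (r i) (hx i) (hy i) hs ht hst

/-- The point with prescribed coordinates in the frame of the orthotope. -/
lemma exists_inner_eq (y : Fin d → ℝ) : ∃ x : Eucl d, ∀ i, inner ℝ (b i) (x - c) = y i := by
  refine ⟨c + b.repr.symm (WithLp.toLp 2 y), fun i => ?_⟩
  rw [add_sub_cancel_left, ← b.repr_apply_apply]
  simp

lemma isBoundedDomain_box (hr : ∀ i, 0 < r i) : IsBoundedDomain (box b c r) := by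
  obtain ⟨x, hx⟩ := exists_inner_eq b c fun i => r i / 2
  have hne : (box b c r).Nonempty :=
    ⟨x, fun i => by rw [hx i]; constructor <;> linarith [hr i]⟩
  exact ⟨hne, isOpen_box b c, isBounded_box b c, hne, (convex_box b c).isPreconnected⟩

/-- Near a boundary point only the faces through it matter. The sum `w` of their inward normals
makes an acute angle with each of them, so each of the half-spaces lies above a Lipschitz graph over
`wᗮ`, and their intersection lies above the maximum of these graphs. -/
lemma hasLipschitzBoundary_box (hr : ∀ i, 0 < r i) : HasLipschitzBoundary (box b c r) := by
  intro x hx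
  rw [frontier, Set.mem_sdiff, (isOpen_box b c).interior_eq] at hx
  obtain ⟨hxc, hxb⟩ := hx
  have hxc' := closure_box_subset b c hxc
  set A : Finset (Fin d) := Finset.univ.filter fun i =>
    inner ℝ (b i) (x - c) = 0 ∨ inner ℝ (b i) (x - c) = r i with hA
  have hAne : A.Nonempty := by
    by_contra hemp
    apply hxb
    intro i
    have hi : i ∉ A := fun h => hemp ⟨i, h⟩
    simp only [hA, Finset.mem_filter, Finset.mem_univ, true_and, not_or] at hi
    exact ⟨lt_of_le_of_ne (hxc' i).1 (Ne.symm hi.1), lt_of_le_of_ne (hxc' i).2 hi.2⟩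
  -- For `i ∈ A`, `σ i • b i` is the inward normal of the face; the value for other `i` plays no
  -- role.
  set σ : Fin d → ℝ := fun i => if inner ℝ (b i) (x - c) = 0 then 1 else -1 with hσ
  have hσσ : ∀ i, σ i * σ i = 1 := by
    intro i; simp only [hσ]; split_ifs <;> norm_num
  set w : Eucl d := ∑ i ∈ A, σ i • b i with hw
  have hbw : ∀ i ∈ A, inner ℝ (b i) w = σ i := by
    intro i hi
    rw [hw, inner_sum, Finset.sum_eq_single i]
    · simp [inner_smul_right]
    · intro j _ hji
      rw [inner_smul_right, b.inner_eq_zero (Ne.symm hji), mul_zero]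
    · exact fun h => absurd hi h
  have hw0 : w ≠ 0 := by
    obtain ⟨i, hi⟩ := hAne
    intro h
    have h1 := hbw i hi
    have h2 := hσσ i
    rw [h, inner_zero_right] at h1
    rw [← h1] at h2
    norm_num at h2
  have hwn : 0 < ‖w‖ := norm_pos_iff.2 hw0
  set e : Eucl d := ‖w‖⁻¹ • w with he
  have hbe : ∀ i ∈ A, ‖w‖ * σ i * inner ℝ (b i) e = 1 := by
    intro i hi
    rw [he, inner_smul_right, hbw i hi]
    field_simp
    rw [← hσσ i]; ring
  -- Each term is the height `t` at which `z + t • e` crosses the face `i`, since `σ i * inner (b i)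
  -- e = ‖w‖⁻¹`.
  set g : Eucl d → ℝ := fun z => A.sup' hAne fun i => ‖w‖ * σ i * inner ℝ (b i) (x - z) with hg
  have hnear : ∀ᶠ y in 𝓝 x, ∀ i, (y ∈ {y : Eucl d | inner ℝ (b i) (y - c) ∈ Ioo 0 (r i)} ↔
      (i ∈ A → 0 < σ i * inner ℝ (b i) (y - x))) := by
    rw [eventually_all]
    intro i
    have hcont : ContinuousAt (fun y : Eucl d => (inner ℝ (b i) (y - c) : ℝ)) x := by fun_prop
    have hsplit : ∀ y : Eucl d, inner ℝ (b i) (y - x) =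
        inner ℝ (b i) (y - c) - inner ℝ (b i) (x - c) := by
      intro y; rw [← inner_sub_right]; congr 1; abel
    by_cases h0 : inner ℝ (b i) (x - c) = 0
    · have hi : i ∈ A := by simp [hA, h0]
      filter_upwards [hcont.eventually_lt_const (show inner ℝ (b i) (x - c) < r i by
        rw [h0]; exact hr i)] with y hy
      rw [hsplit y, h0]
      simp [hσ, h0, hi, hy]
    by_cases h1 : inner ℝ (b i) (x - c) = r i
    · have hi : i ∈ A := by simp [hA, h1]
      filter_upwards [hcont.eventually_const_lt (show 0 < inner ℝ (b i) (x - c) by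
        rw [h1]; exact hr i)] with y hy
      rw [hsplit y, h1]
      simp [hσ, h1, hi, hy, (hr i).ne']
    · have hi : i ∉ A := by simp [hA, h0, h1]
      filter_upwards [hcont.eventually_const_lt (lt_of_le_of_ne (hxc' i).1 (Ne.symm h0)),
        hcont.eventually_lt_const (lt_of_le_of_ne (hxc' i).2 h1)] with y hy hy'
      simp [hi, hy, hy']
  obtain ⟨ρ, hρ, hball⟩ := Metric.eventually_nhds_iff_ball.1 hnear
  refine ⟨ρ, e, ‖w‖₊, g, hρ, ?_, ?_, fun y hy => ?_⟩
  · rw [he, norm_smul, norm_inv, norm_norm, inv_mul_cancel₀ hwn.ne']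
  · refine LipschitzWith.of_le_add_mul _ fun z z' => ?_
    refine Finset.sup'_le _ _ fun i hi => ?_
    have h1 : ‖w‖ * σ i * inner ℝ (b i) (x - z') ≤ g z' :=
      Finset.le_sup' (fun i => ‖w‖ * σ i * inner ℝ (b i) (x - z')) hi
    have h2 : ‖w‖ * σ i * inner ℝ (b i) (x - z) = ‖w‖ * σ i * inner ℝ (b i) (x - z') +
        ‖w‖ * (σ i * inner ℝ (b i) (z' - z)) := by
      simp only [inner_sub_right]; ring
    have h3 : σ i * inner ℝ (b i) (z' - z) ≤ dist z z' := by
      have h4 : |inner ℝ (b i) (z' - z)| ≤ dist z z' := by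
        have := abs_real_inner_le_norm (b i) (z' - z)
        rwa [b.norm_eq_one, one_mul, ← dist_eq_norm, dist_comm] at this
      refine le_trans ?_ h4
      simp only [hσ]
      split_ifs
      · simpa using le_abs_self _
      · simpa using neg_le_abs _
    rw [h2]
    have h5 := mul_le_mul_of_nonneg_left h3 hwn.le
    simp only [coe_nnnorm]
    linarith
  · have hy' := hball y hy
    have e1 : y ∈ box b c r ↔ ∀ i ∈ A, 0 < σ i * inner ℝ (b i) (y - x) := forall_congr' hy'
    rw [e1, hg, Finset.sup'_lt_iff]
    refine forall₂_congr fun i hi => ?_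
    have e2 : ‖w‖ * σ i * inner ℝ (b i) (x - (y - inner ℝ e y • e)) =
        inner ℝ e y - ‖w‖ * (σ i * inner ℝ (b i) (y - x)) := by
      simp only [inner_sub_right, inner_smul_right]
      linear_combination (inner ℝ e y) * hbe i hi
    rw [e2, sub_lt_self_iff, mul_pos_iff_of_pos_left hwn]

/-- The coordinates in the frame of an orthotope. -/
noncomputable def boxCoord (x : Eucl d) : Fin d → ℝ := fun i => inner ℝ (b i) (x - c)

lemma measurePreserving_boxCoord : MeasurePreserving (boxCoord b c) := by
  have h1 := measurePreserving_sub_right (volume : Measure (Eucl d)) c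
  have h2 := b.measurePreserving_repr
  have h3 := PiLp.volume_preserving_ofLp (Fin d)
  convert! h3.comp (h2.comp h1) using 1
  ext x i
  simp [boxCoord, b.repr_apply_apply, inner_sub_right]

lemma measurableEmbedding_boxCoord : MeasurableEmbedding (boxCoord b c) := by
  have h1 := (MeasurableEquiv.subRight c).measurableEmbedding
  have h2 := b.measurableEquiv.measurableEmbedding
  have h3 := (MeasurableEquiv.toLp 2 (Fin d → ℝ)).symm.measurableEmbedding
  convert! h3.comp (h2.comp h1) using 1
  ext x i
  simp [boxCoord, OrthonormalBasis.measurableEquiv, b.repr_apply_apply]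
  rfl

/-- Fubini in the frame of the box. It reduces orthogonality and couplings of the modes to integrals
in one variable. -/
lemma setIntegral_box_prod (f : Fin d → ℝ → ℝ) :
    ∫ x in box b c r, ∏ i, f i (inner ℝ (b i) (x - c)) = ∏ i, ∫ t in Ioo 0 (r i), f i t := by
  have hpre : box b c r = boxCoord b c ⁻¹' (univ.pi fun i => Ioo 0 (r i)) := by
    ext x; simp only [box, boxCoord, mem_preimage, mem_univ_pi, mem_ofPred_eq]
  rw [hpre]
  have := (measurePreserving_boxCoord b c).setIntegral_preimage_emb
    (measurableEmbedding_boxCoord b c) (fun y => ∏ i, f i (y i)) (univ.pi fun i => Ioo 0 (r i))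
  simp only [boxCoord] at this ⊢
  rw [this, volume_pi, Measure.restrict_pi_pi, integral_fintype_prod_eq_prod]

end Box

/-! ### One-dimensional integrals -/

lemma integral_Ioo_cos {a r : ℝ} (hr : 0 ≤ r) (ha : a ≠ 0) :
    ∫ t in Ioo 0 r, Real.cos (a * t) = Real.sin (a * r) / a := by
  rw [← integral_Ioc_eq_integral_Ioo, ← intervalIntegral.integral_of_le hr]
  rw [intervalIntegral.integral_eq_sub_of_hasDerivAt (f := fun t => Real.sin (a * t) / a)]
  · simp
  · intro t _
    have := ((Real.hasDerivAt_sin (a * t)).comp t ((hasDerivAt_id t).const_mul a)).div_const a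
    convert! this using 1
    field_simp
  · exact (by fun_prop : Continuous fun t => Real.cos (a * t)).intervalIntegrable _ _

lemma integral_Ioo_mul_cos {a r : ℝ} (hr : 0 ≤ r) (ha : a ≠ 0) :
    ∫ t in Ioo 0 r, t * Real.cos (a * t) =
      r * Real.sin (a * r) / a + (Real.cos (a * r) - 1) / a ^ 2 := by
  rw [← integral_Ioc_eq_integral_Ioo, ← intervalIntegral.integral_of_le hr]
  rw [intervalIntegral.integral_eq_sub_of_hasDerivAt
    (f := fun t => t * Real.sin (a * t) / a + Real.cos (a * t) / a ^ 2)]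
  · simp; ring
  · intro t _
    have h1 := (Real.hasDerivAt_sin (a * t)).comp t ((hasDerivAt_id t).const_mul a)
    have h2 := (Real.hasDerivAt_cos (a * t)).comp t ((hasDerivAt_id t).const_mul a)
    have := (((hasDerivAt_id t).mul h1).div_const a).add (h2.div_const (a ^ 2))
    convert! this using 1
    simp
    field_simp
    ring
  · exact (by fun_prop : Continuous fun t => t * Real.cos (a * t)).intervalIntegrable _ _

/-- The normalized Dirichlet eigenfunctions of `(0, r)`. -/
noncomputable def sineMode (r : ℝ) (k : ℕ) (t : ℝ) : ℝ :=
  √(2 / r) * Real.sin (((k : ℝ) + 1) * Real.pi / r * t)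

lemma sineMode_mul {r : ℝ} (hr : 0 < r) (k m : ℕ) (t : ℝ) :
    sineMode r k t * sineMode r m t =
      r⁻¹ * (Real.cos (((k : ℝ) - m) * Real.pi / r * t) -
        Real.cos (((k : ℝ) + m + 2) * Real.pi / r * t)) := by
  have h1 : ((k : ℝ) - m) * Real.pi / r * t =
      ((k : ℝ) + 1) * Real.pi / r * t - ((m : ℝ) + 1) * Real.pi / r * t := by ring
  have h2 : ((k : ℝ) + m + 2) * Real.pi / r * t =
      ((k : ℝ) + 1) * Real.pi / r * t + ((m : ℝ) + 1) * Real.pi / r * t := by ring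
  rw [h1, h2, Real.cos_sub, Real.cos_add, sineMode, sineMode]
  have h3 : √(2 / r) * √(2 / r) = 2 * r⁻¹ := by
    rw [Real.mul_self_sqrt (by positivity)]; ring
  linear_combination (Real.sin (((k : ℝ) + 1) * Real.pi / r * t) *
    Real.sin (((m : ℝ) + 1) * Real.pi / r * t)) * h3

lemma sin_int_mul_pi_div {r : ℝ} (hr : 0 < r) (n : ℤ) : Real.sin (n * Real.pi / r * r) = 0 := by
  rw [div_mul_cancel₀ _ hr.ne', Real.sin_int_mul_pi]

lemma integral_cos_int {r : ℝ} (hr : 0 < r) {n : ℤ} (hn : n ≠ 0) :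
    ∫ t in Ioo 0 r, Real.cos (n * Real.pi / r * t) = 0 := by
  have hn' : (n : ℝ) ≠ 0 := by exact_mod_cast hn
  rw [integral_Ioo_cos hr.le (by positivity), sin_int_mul_pi_div hr, zero_div]

lemma integrableOn_Ioo_of_continuous {f : ℝ → ℝ} (hf : Continuous f) (a b : ℝ) :
    IntegrableOn f (Ioo a b) :=
  (hf.integrableOn_Icc (a := a) (b := b)).mono_set Ioo_subset_Icc_self

lemma integral_sineMode_mul {r : ℝ} (hr : 0 < r) (k m : ℕ) :
    ∫ t in Ioo 0 r, sineMode r k t * sineMode r m t = if k = m then 1 else 0 := by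
  simp_rw [sineMode_mul hr]
  rw [integral_const_mul, integral_sub (integrableOn_Ioo_of_continuous (by fun_prop) _ _)
    (integrableOn_Ioo_of_continuous (by fun_prop) _ _)]
  have h2 := integral_cos_int hr (n := k + m + 2) (by omega)
  push_cast at h2
  rw [h2, sub_zero]
  split_ifs with h
  · subst h
    simp [hr.le, hr.ne']
  · have h1 := integral_cos_int hr (n := k - m) (by omega)
    push_cast at h1
    rw [h1, mul_zero]

/-- The lower bound on `C` does not depend on the modes, which is what allows one box to serve
infinitely many couplings. -/
lemma integral_mul_sineMode_succ {r : ℝ} (hr : 0 < r) (k m : ℕ) (hkm : k + 1 = m ∨ m + 1 = k) :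
    ∃ C, 16 / 9 ≤ C ∧ ∫ t in Ioo 0 r, t * (sineMode r k t * sineMode r m t) =
      -(r / Real.pi ^ 2 * C) := by
  -- The cosines of frequencies `k - m = ±1` and `k + m + 2` give `-2` and `2 / (k + m + 2) ^ 2`.
  -- Since `k + m ≥ 1`, the worst case is `2 - 2 / 9 = 16 / 9`.
  refine ⟨2 - 2 / ((k : ℝ) + m + 2) ^ 2, ?_, ?_⟩
  · have : (3 : ℝ) ≤ (k : ℝ) + m + 2 := by
      have : 1 ≤ k + m := by omega
      have : (1 : ℝ) ≤ (k : ℝ) + m := by exact_mod_cast this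
      linarith
    have h9 : (9 : ℝ) ≤ ((k : ℝ) + m + 2) ^ 2 := by nlinarith
    have : 2 / ((k : ℝ) + m + 2) ^ 2 ≤ 2 / 9 := by gcongr
    linarith
  simp_rw [sineMode_mul hr]
  have hpi := Real.pi_pos
  have e : ∀ t : ℝ, t * (r⁻¹ * (Real.cos (((k : ℝ) - m) * Real.pi / r * t) -
        Real.cos (((k : ℝ) + m + 2) * Real.pi / r * t))) =
      r⁻¹ * (t * Real.cos (((k : ℝ) - m) * Real.pi / r * t) -
        t * Real.cos (((k : ℝ) + m + 2) * Real.pi / r * t)) := fun t => by ring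
  simp_rw [e]
  rw [integral_const_mul, integral_sub (integrableOn_Ioo_of_continuous (by fun_prop) _ _)
    (integrableOn_Ioo_of_continuous (by fun_prop) _ _)]
  have hk : ((k : ℝ) - m) ^ 2 = 1 := by
    rcases hkm with rfl | rfl <;> push_cast <;> ring
  have hkm0 : (k : ℝ) - m ≠ 0 := by
    intro h; rw [h] at hk; norm_num at hk
  have hp : (0 : ℝ) < (k : ℝ) + m + 2 := by positivity
  rw [integral_Ioo_mul_cos hr.le (by positivity), integral_Ioo_mul_cos hr.le (by positivity)]
  have s1 := sin_int_mul_pi_div hr (k - m)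
  have s2 := sin_int_mul_pi_div hr (k + m + 2)
  push_cast at s1 s2
  rw [s1, s2, div_mul_cancel₀ _ hr.ne', div_mul_cancel₀ _ hr.ne']
  have c1 : Real.cos (((k : ℝ) - m) * Real.pi) = -1 := by
    rcases hkm with rfl | rfl
    · push_cast
      rw [show ((k : ℝ) - (k + 1)) * Real.pi = -Real.pi by ring, Real.cos_neg, Real.cos_pi]
    · push_cast
      rw [show ((m : ℝ) + 1 - m) * Real.pi = Real.pi by ring, Real.cos_pi]
  have c2 : Real.cos (((k : ℝ) + m + 2) * Real.pi) = -1 := by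
    rcases hkm with rfl | rfl
    · have := Real.cos_nat_mul_two_pi_add_pi (k + 1)
      push_cast at this ⊢
      rw [← this]; congr 1; ring
    · have := Real.cos_nat_mul_two_pi_add_pi (m + 1)
      push_cast at this ⊢
      rw [← this]; congr 1; ring
  rw [c1, c2]
  have e3 : (((k : ℝ) - m) * Real.pi / r) ^ 2 = Real.pi ^ 2 / r ^ 2 := by
    rw [div_pow, mul_pow, hk, one_mul]
  rw [e3]
  field_simp
  ring

/-! ### Smooth functions in `H¹₀` and weak eigenfunctions -/

section H10

variable {d : ℕ} {ω : Set (Eucl d)}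

lemma gradient_sub_eq (f g : Eucl d → ℝ) (x : Eucl d) :
    ‖gradient f x - gradient g x‖ = ‖fderiv ℝ f x - fderiv ℝ g x‖ := by
  rw [gradient, gradient, ← map_sub, LinearIsometryEquiv.norm_map]

lemma continuous_gradient {f : Eucl d → ℝ} (hf : ContDiff ℝ (⊤ : ℕ∞) f) :
    Continuous (gradient f) :=
  (InnerProductSpace.toDual ℝ (Eucl d)).symm.continuous.comp (hf.continuous_fderiv (by simp))

lemma exists_bound_of_continuous {E : Type*} [NormedAddCommGroup E] {f : Eucl d → E}
    (hf : Continuous f) (hω : Bornology.IsBounded ω) : ∃ C, 0 ≤ C ∧ ∀ x ∈ ω, ‖f x‖ ≤ C := by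
  obtain ⟨C, hC⟩ := hω.isCompact_closure.exists_bound_of_continuousOn hf.continuousOn
  exact ⟨max C 0, le_max_right _ _, fun x hx => (hC x (subset_closure hx)).trans (le_max_left _ _)⟩

lemma memLp_of_continuous {E : Type*} [NormedAddCommGroup E]
    {f : Eucl d → E} (hf : Continuous f) (hω : IsOpen ω) (hb : Bornology.IsBounded ω) (p : ℝ≥0∞) :
    MemLp f p (volume.restrict ω) := by
  obtain ⟨C, -, hC⟩ := exists_bound_of_continuous hf hb
  have : IsFiniteMeasure ((volume : Measure (Eucl d)).restrict ω) :=
    ⟨by simpa using hb.measure_lt_top⟩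
  refine MemLp.of_bound hf.aestronglyMeasurable C ?_
  filter_upwards [ae_restrict_mem hω.measurableSet] with x hx using hC x hx

lemma tendsto_eLpNorm_two_zero {E : Type*} [NormedAddCommGroup E] (hω : IsOpen ω)
    (hb : Bornology.IsBounded ω) {f : ℕ → Eucl d → E} (hf : ∀ n, Continuous (f n)) {M : ℝ}
    (hM : ∀ n, ∀ x ∈ ω, ‖f n x‖ ≤ M) (h0 : ∀ x ∈ ω, ∀ᶠ n in atTop, f n x = 0) :
    Tendsto (fun n => eLpNorm (f n) 2 (volume.restrict ω)) atTop (𝓝 0) := by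
  have hfin : IsFiniteMeasure ((volume : Measure (Eucl d)).restrict ω) :=
    ⟨by simpa using hb.measure_lt_top⟩
  have key : Tendsto (fun n => ∫⁻ x in ω, ‖f n x‖ₑ ^ (2 : ℝ)) atTop (𝓝 (∫⁻ _ in ω, 0)) := by
    refine tendsto_lintegral_of_dominated_convergence (fun _ => ENNReal.ofReal M ^ (2 : ℝ))
      (fun n => ((hf n).enorm.measurable.pow_const _)) (fun n => ?_) ?_ ?_
    · filter_upwards [ae_restrict_mem hω.measurableSet] with x hx
      gcongr
      rw [← ofReal_norm]
      exact ENNReal.ofReal_le_ofReal (hM n x hx)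
    · rw [lintegral_const]
      exact ENNReal.mul_ne_top (ENNReal.rpow_ne_top_of_nonneg (by norm_num) ENNReal.ofReal_ne_top)
        (measure_ne_top _ _)
    · filter_upwards [ae_restrict_mem hω.measurableSet] with x hx
      refine tendsto_const_nhds.congr' ?_
      filter_upwards [h0 x hx] with n hn
      simp [hn]
  simp only [lintegral_zero] at key
  have h2 := (ENNReal.continuous_rpow_const (y := 1 / 2)).tendsto (0 : ℝ≥0∞)
  rw [ENNReal.zero_rpow_of_pos (by norm_num)] at h2
  refine (h2.comp key).congr fun n => ?_
  rw [eLpNorm_eq_lintegral_rpow_enorm_toReal (by norm_num) (by norm_num)]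
  simp

/-- A smooth step: `0` on `(-∞, 1]` and `1` on `[2, ∞)`. -/
noncomputable def smoothStep (t : ℝ) : ℝ := Real.smoothTransition (t - 1)

lemma contDiff_smoothStep : ContDiff ℝ (⊤ : ℕ∞) smoothStep :=
  Real.smoothTransition.contDiff.comp (contDiff_id.sub contDiff_const)

lemma smoothStep_of_le {t : ℝ} (ht : t ≤ 1) : smoothStep t = 0 :=
  Real.smoothTransition.zero_of_nonpos (by linarith)

lemma smoothStep_of_ge {t : ℝ} (ht : 2 ≤ t) : smoothStep t = 1 :=
  Real.smoothTransition.one_of_one_le (by linarith)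

lemma abs_one_sub_smoothStep_le (t : ℝ) : |1 - smoothStep t| ≤ 1 := by
  have h1 := Real.smoothTransition.nonneg (t - 1)
  have h2 := Real.smoothTransition.le_one (t - 1)
  rw [smoothStep, abs_le]
  constructor <;> linarith

lemma deriv_smoothStep_of_lt {t : ℝ} (ht : t < 1) : deriv smoothStep t = 0 := by
  have : smoothStep =ᶠ[𝓝 t] fun _ => 0 := by
    filter_upwards [eventually_lt_nhds ht] with s hs using smoothStep_of_le hs.le
  rw [this.deriv_eq]; simp

lemma deriv_smoothStep_of_gt {t : ℝ} (ht : 2 < t) : deriv smoothStep t = 0 := by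
  have : smoothStep =ᶠ[𝓝 t] fun _ => 1 := by
    filter_upwards [eventually_gt_nhds ht] with s hs using smoothStep_of_ge hs.le
  rw [this.deriv_eq]; simp

/-- The derivative vanishes off `[1, 2]`. The bound absorbs the factor `n` that arises on
differentiating `smoothStep (n * w)`. -/
lemma exists_bound_mul_deriv_smoothStep :
    ∃ B, 0 ≤ B ∧ ∀ t, |t * deriv smoothStep t| ≤ B := by
  have hc : Continuous fun t => t * deriv smoothStep t :=
    continuous_id.mul (contDiff_smoothStep.continuous_deriv (by simp))
  obtain ⟨B, hB⟩ := (isCompact_Icc (a := (1 : ℝ)) (b := 2)).exists_bound_of_continuousOn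
    hc.continuousOn
  refine ⟨max B 0, le_max_right _ _, fun t => ?_⟩
  rcases lt_or_ge t 1 with h1 | h1
  · simp [deriv_smoothStep_of_lt h1]
  rcases lt_or_ge 2 t with h2 | h2
  · simp [deriv_smoothStep_of_gt h2]
  · exact (hB t ⟨h1, h2⟩).trans (le_max_left _ _)

/-- Integration by parts against a test function. -/
lemma setIntegral_mul_fderiv_test {f : Eucl d → ℝ} (hf : ContDiff ℝ (⊤ : ℕ∞) f)
    {ψ : Eucl d → ℝ} (hψ : IsTestFunction ω ψ) (v : Eucl d) :
    ∫ x in ω, f x * fderiv ℝ ψ x v = -∫ x in ω, fderiv ℝ f x v * ψ x := by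
  have hψc := hψ.contDiff.continuous
  have hf'c : Continuous fun x => fderiv ℝ f x v :=
    (hf.continuous_fderiv (by simp)).clm_apply continuous_const
  have hψ'c : Continuous fun x => fderiv ℝ ψ x v :=
    (hψ.contDiff.continuous_fderiv (by simp)).clm_apply continuous_const
  have hψ's : HasCompactSupport fun x => fderiv ℝ ψ x v :=
    (hψ.hasCompactSupport.fderiv (𝕜 := ℝ)).comp_left (g := fun L : Eucl d →L[ℝ] ℝ => L v) (by simp)
  have hz : ∀ x, x ∉ ω → ψ x = 0 := fun x hx =>
    image_eq_zero_of_notMem_tsupport fun h => hx (hψ.tsupport_subset h)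
  have hz' : ∀ x, x ∉ ω → fderiv ℝ ψ x = 0 := fun x hx =>
    image_eq_zero_of_notMem_tsupport fun h =>
      hx (hψ.tsupport_subset (tsupport_fderiv_subset ℝ h))
  rw [setIntegral_eq_integral_of_forall_compl_eq_zero (fun x hx => by simp [hz' x hx]),
    setIntegral_eq_integral_of_forall_compl_eq_zero (fun x hx => by simp [hz x hx])]
  refine integral_mul_fderiv_eq_neg_fderiv_mul_of_integrable ?_ ?_ ?_ ?_ ?_
  · exact (hf'c.mul hψc).integrable_of_hasCompactSupport (hψ.hasCompactSupport.mul_left)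
  · exact (hf.continuous.mul hψ'c).integrable_of_hasCompactSupport (hψ's.mul_left)
  · exact (hf.continuous.mul hψc).integrable_of_hasCompactSupport (hψ.hasCompactSupport.mul_left)
  · exact fun x _ => hf.differentiable (by simp) x
  · exact fun x _ => hψ.contDiff.differentiable (by simp) x

lemma hasWeakGradientOn_gradient (hω : IsOpen ω) (hb : Bornology.IsBounded ω) {φ : Eucl d → ℝ}
    (hφ : ContDiff ℝ (⊤ : ℕ∞) φ) : HasWeakGradientOn ω φ (gradient φ) := by
  intro ψ hψ
  have hi1 : IntegrableOn (fun x => φ x • gradient ψ x) ω := memLp_one_iff_integrable.1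
    (memLp_of_continuous (hφ.continuous.smul (continuous_gradient hψ.contDiff)) hω hb 1)
  have hi2 : IntegrableOn (fun x => ψ x • gradient φ x) ω := memLp_one_iff_integrable.1
    (memLp_of_continuous (hψ.contDiff.continuous.smul (continuous_gradient hφ)) hω hb 1)
  refine ext_inner_left ℝ fun v => ?_
  rw [inner_neg_right, ← integral_inner hi1 v, ← integral_inner hi2 v]
  simp only [inner_smul_right, inner_gradient_right, conj_trivial]
  rw [setIntegral_mul_fderiv_test hφ hψ v]
  simp only [mul_comm]

/-- The truncation of `φ` near the zeros of `w`. -/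
noncomputable def truncate (ω : Set (Eucl d)) (φ w : Eucl d → ℝ) (n : ℕ) : Eucl d → ℝ :=
  ω.indicator fun x => φ x * smoothStep (n * w x)

/-- The support lies in the part of the closure of `ω` where `n * w ≥ 1`. This set is compact and
avoids the boundary, where `w` vanishes. -/
lemma isTestFunction_truncate (hω : IsOpen ω) (hb : Bornology.IsBounded ω) {φ w : Eucl d → ℝ}
    (hφ : ContDiff ℝ (⊤ : ℕ∞) φ) (hw : ContDiff ℝ (⊤ : ℕ∞) w)
    (hw0 : ∀ x ∈ closure ω, x ∉ ω → w x = 0) (n : ℕ) :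
    IsTestFunction ω (truncate ω φ w n) := by
  have hsm : ContDiff ℝ (⊤ : ℕ∞) fun x => φ x * smoothStep (n * w x) :=
    hφ.mul (contDiff_smoothStep.comp (contDiff_const.mul hw))
  set K := closure ω ∩ {x | 1 ≤ n * w x} with hK
  have hKclosed : IsClosed K := isClosed_closure.inter
    (isClosed_le continuous_const (continuous_const.mul hw.continuous))
  have hKω : K ⊆ ω := by
    rintro x ⟨h1, h2⟩
    by_contra hx
    simp only [mem_ofPred_eq, hw0 x h1 hx, mul_zero] at h2
    linarith
  have hsupp : tsupport (truncate ω φ w n) ⊆ K := by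
    refine closure_minimal (fun x hx => ?_) hKclosed
    have hxω : x ∈ ω := mem_of_indicator_ne_zero hx
    refine ⟨subset_closure hxω, ?_⟩
    by_contra hlt
    apply hx
    simp only [mem_ofPred_eq, not_le] at hlt
    simp [truncate, hxω, smoothStep_of_le hlt.le]
  refine ⟨contDiff_iff_contDiffAt.2 fun x => ?_, ?_, hsupp.trans hKω⟩
  · by_cases hx : x ∈ ω
    · refine hsm.contDiffAt.congr_of_eventuallyEq ?_
      filter_upwards [hω.mem_nhds hx] with y hy
      simp [truncate, hy]
    · refine contDiffAt_const (c := (0 : ℝ)) |>.congr_of_eventuallyEq ?_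
      exact notMem_tsupport_iff_eventuallyEq.1 fun h => hx (hKω (hsupp h))
  · exact HasCompactSupport.of_support_subset_isCompact
      (hb.isCompact_closure.of_isClosed_subset hKclosed inter_subset_left)
      ((subset_tsupport _).trans hsupp)

/-- The truncations converge in `H¹` by dominated convergence. The dangerous term in their gradient
is `n * φ * smoothStep' (n * w)` times the gradient of `w`; as `|φ| ≤ C * w`, it is controlled by `t
* smoothStep' t` at `t = n * w`, which is bounded. At each point the difference vanishes once `n * w
> 2`. -/
lemma memH10_of_abs_le (hω : IsOpen ω) (hb : Bornology.IsBounded ω) {φ w : Eucl d → ℝ}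
    (hφ : ContDiff ℝ (⊤ : ℕ∞) φ) (hw : ContDiff ℝ (⊤ : ℕ∞) w)
    (hw0 : ∀ x ∈ closure ω, x ∉ ω → w x = 0) (hwpos : ∀ x ∈ ω, 0 < w x)
    {C : ℝ} (hC : 0 ≤ C) (hφw : ∀ x ∈ ω, |φ x| ≤ C * w x) :
    MemH10 ω φ (gradient φ) := by
  have htest := isTestFunction_truncate hω hb hφ hw hw0
  obtain ⟨M0, hM00, hM0⟩ := exists_bound_of_continuous hφ.continuous hb
  obtain ⟨M1, hM10, hM1⟩ := exists_bound_of_continuous (hφ.continuous_fderiv (by simp)) hb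
  obtain ⟨M2, hM20, hM2⟩ := exists_bound_of_continuous (hw.continuous_fderiv (by simp)) hb
  obtain ⟨B, hB0, hB⟩ := exists_bound_mul_deriv_smoothStep
  have hlarge : ∀ x ∈ ω, ∀ᶠ n : ℕ in atTop, 2 < n * w x := by
    intro x hx
    have := (tendsto_natCast_atTop_atTop (R := ℝ)).atTop_mul_const (hwpos x hx)
    exact this.eventually_gt_atTop 2
  have hderiv : ∀ n : ℕ, ∀ x ∈ ω, fderiv ℝ φ x - fderiv ℝ (truncate ω φ w n) x =
      (1 - smoothStep (n * w x)) • fderiv ℝ φ x -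
        (φ x * (deriv smoothStep (n * w x) * n)) • fderiv ℝ w x := by
    intro n x hx
    have heq : truncate ω φ w n =ᶠ[𝓝 x] fun x => φ x * smoothStep (n * w x) := by
      filter_upwards [hω.mem_nhds hx] with y hy
      simp [truncate, hy]
    rw [heq.fderiv_eq]
    have hw' := (hw.differentiable (by simp) x).hasFDerivAt
    have hφ' := (hφ.differentiable (by simp) x).hasFDerivAt
    have hs' : HasDerivAt smoothStep (deriv smoothStep (n * w x)) (n * w x) :=
      (contDiff_smoothStep.differentiable (by simp) _).hasDerivAt
    have h1 := hφ'.mul (hs'.comp_hasFDerivAt x (hw'.const_mul (n : ℝ)))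
    have h2 : fderiv ℝ (fun x => φ x * smoothStep (n * w x)) x = _ := h1.fderiv
    rw [h2]
    ext v
    simp
    ring
  have t0 : Tendsto (fun n => eLpNorm (fun x => φ x - truncate ω φ w n x) 2 (volume.restrict ω))
      atTop (𝓝 0) := by
    refine tendsto_eLpNorm_two_zero hω hb
      (fun n => hφ.continuous.sub (htest n).contDiff.continuous) (M := M0) (fun n x hx => ?_)
      fun x hx => ?_
    · have : φ x - truncate ω φ w n x = φ x * (1 - smoothStep (n * w x)) := by
        simp [truncate, hx]; ring
      rw [this, norm_mul]
      exact (mul_le_of_le_one_right (norm_nonneg _) (abs_one_sub_smoothStep_le _)).trans (hM0 x hx)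
    · filter_upwards [hlarge x hx] with n hn
      simp [truncate, hx, smoothStep_of_ge hn.le]
  have t1 : Tendsto (fun n => eLpNorm (fun x => gradient φ x - gradient (truncate ω φ w n) x) 2
      (volume.restrict ω)) atTop (𝓝 0) := by
    refine tendsto_eLpNorm_two_zero hω hb
      (fun n => (continuous_gradient hφ).sub (continuous_gradient (htest n).contDiff))
      (M := M1 + C * B * M2) (fun n x hx => ?_) fun x hx => ?_
    · rw [gradient_sub_eq, hderiv n x hx]
      refine (norm_sub_le _ _).trans (add_le_add ?_ ?_)
      · rw [norm_smul]
        exact (mul_le_of_le_one_left (norm_nonneg _) (abs_one_sub_smoothStep_le _)).trans (hM1 x hx)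
      · rw [norm_smul]
        refine mul_le_mul ?_ (hM2 x hx) (norm_nonneg _) (by positivity)
        have h1 := hB (n * w x)
        rw [abs_mul, abs_of_nonneg (mul_nonneg n.cast_nonneg (hwpos x hx).le)] at h1
        rw [Real.norm_eq_abs, abs_mul, abs_mul, Nat.abs_cast]
        calc |φ x| * (|deriv smoothStep (n * w x)| * n)
            ≤ C * w x * (|deriv smoothStep (n * w x)| * n) := by
              gcongr; exact hφw x hx
          _ = C * (n * w x * |deriv smoothStep (n * w x)|) := by ring
          _ ≤ C * B := by gcongr
    · filter_upwards [hlarge x hx] with n hn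
      rw [← norm_eq_zero, gradient_sub_eq, hderiv n x hx, smoothStep_of_ge hn.le,
        deriv_smoothStep_of_gt hn]
      simp
  refine ⟨memLp_of_continuous hφ.continuous hω hb 2,
    memLp_of_continuous (continuous_gradient hφ) hω hb 2, hasWeakGradientOn_gradient hω hb hφ,
    fun ε hε => ?_⟩
  obtain ⟨n, h1, h2⟩ := ((t0.eventually_lt_const hε).and (t1.eventually_lt_const hε)).exists
  exact ⟨_, htest n, h1, h2⟩

/-! ### Weak eigenfunctions and their orthogonality -/

lemma weak_eigen_of_smooth (hω : IsOpen ω) (hb : Bornology.IsBounded ω)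
    (b : OrthonormalBasis (Fin d) ℝ (Eucl d)) {φ : Eucl d → ℝ} (hφ : ContDiff ℝ (⊤ : ℕ∞) φ) {μ : ℝ}
    (hμ : ∀ x, ∑ i, fderiv ℝ (fun y => fderiv ℝ φ y (b i)) x (b i) = -μ * φ x)
    {ψ : Eucl d → ℝ} (hψ : IsTestFunction ω ψ) :
    ∫ x in ω, inner ℝ (gradient φ x) (gradient ψ x) = μ * ∫ x in ω, φ x * ψ x := by
  have hd : ∀ i, ContDiff ℝ (⊤ : ℕ∞) fun y => fderiv ℝ φ y (b i) := fun i =>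
    (hφ.fderiv_right (by simp)).clm_apply contDiff_const
  have hint : ∀ f : Eucl d → ℝ, Continuous f → IntegrableOn f ω := fun f hf =>
    memLp_one_iff_integrable.1 (memLp_of_continuous hf hω hb 1)
  have hψ' : ∀ i, Continuous fun y => fderiv ℝ ψ y (b i) := fun i =>
    (hψ.contDiff.continuous_fderiv (by simp)).clm_apply continuous_const
  have hdd : ∀ i, Continuous fun y => fderiv ℝ (fun y => fderiv ℝ φ y (b i)) y (b i) := fun i =>
    ((hd i).continuous_fderiv (by simp)).clm_apply continuous_const
  have e1 : ∀ x, inner ℝ (gradient φ x) (gradient ψ x) =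
      ∑ i, fderiv ℝ φ x (b i) * fderiv ℝ ψ x (b i) := by
    intro x
    rw [← b.sum_inner_mul_inner]
    simp only [inner_gradient_left, inner_gradient_right, conj_trivial]
  simp_rw [e1]
  have hi1 : ∀ i ∈ Finset.univ, IntegrableOn
      (fun x => fderiv ℝ φ x (b i) * fderiv ℝ ψ x (b i)) ω := fun i _ =>
    hint _ ((hd i).continuous.mul (hψ' i))
  have hi2 : ∀ i ∈ Finset.univ, IntegrableOn
      (fun x => fderiv ℝ (fun y => fderiv ℝ φ y (b i)) x (b i) * ψ x) ω := fun i _ =>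
    hint _ ((hdd i).mul hψ.contDiff.continuous)
  rw [integral_finsetSum _ hi1]
  simp_rw [fun i => setIntegral_mul_fderiv_test (hd i) hψ (b i)]
  rw [Finset.sum_neg_distrib, ← integral_finsetSum _ hi2]
  simp_rw [← Finset.sum_mul, hμ]
  rw [← integral_neg, ← integral_const_mul]
  congr 1
  ext x
  ring

lemma abs_integral_inner_le {E : Type*} [NormedAddCommGroup E] [InnerProductSpace ℝ E]
    {μ : Measure (Eucl d)} {f g : Eucl d → E} (hf : MemLp f 2 μ) (hg : MemLp g 2 μ) :
    |∫ x, inner ℝ (f x) (g x) ∂μ| ≤ (eLpNorm f 2 μ).toReal * (eLpNorm g 2 μ).toReal := by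
  have h := abs_real_inner_le_norm (hf.toLp f) (hg.toLp g)
  rw [L2.inner_def, Lp.norm_toLp, Lp.norm_toLp] at h
  refine le_trans (le_of_eq ?_) h
  congr 1
  refine integral_congr_ae ?_
  filter_upwards [hf.coeFn_toLp, hg.coeFn_toLp] with x h1 h2
  rw [h1, h2]

lemma integrable_inner {E : Type*} [NormedAddCommGroup E] [InnerProductSpace ℝ E]
    {μ : Measure (Eucl d)} {f g : Eucl d → E} (hf : MemLp f 2 μ) (hg : MemLp g 2 μ) :
    Integrable (fun x => inner ℝ (f x) (g x)) μ := by
  refine (L2.integrable_inner (𝕜 := ℝ) (hf.toLp f) (hg.toLp g)).congr ?_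
  filter_upwards [hf.coeFn_toLp, hg.coeFn_toLp] with x h1 h2
  rw [h1, h2]

/-- Test functions are dense in `H¹₀`, and both sides are continuous in `v` for the `H¹` norm. This
admits a second eigenfunction as test function. -/
lemma weak_eigen_extend (hω : IsOpen ω) (hb : Bornology.IsBounded ω) {u v : Eucl d → ℝ}
    {G H : Eucl d → Eucl d} {μ : ℝ} (hu : MemH10 ω u G) (hv : MemH10 ω v H)
    (h : ∀ ψ : Eucl d → ℝ, IsTestFunction ω ψ →
      ∫ x in ω, inner ℝ (G x) (gradient ψ x) = μ * ∫ x in ω, u x * ψ x) :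
    ∫ x in ω, inner ℝ (G x) (H x) = μ * ∫ x in ω, u x * v x := by
  set a := (eLpNorm G 2 (volume.restrict ω)).toReal
  set c := (eLpNorm u 2 (volume.restrict ω)).toReal
  have key : ∀ ε : ℝ, 0 < ε → |(∫ x in ω, inner ℝ (G x) (H x)) - μ * ∫ x in ω, u x * v x| ≤
      (a + |μ| * c) * ε := by
    intro ε hε
    obtain ⟨ψ, hψ, h1, h2⟩ := hv.approx (ENNReal.ofReal ε) (by simpa using hε)
    have hψL := memLp_of_continuous hψ.contDiff.continuous hω hb 2
    have hψL' := memLp_of_continuous (continuous_gradient hψ.contDiff) hω hb 2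
    have i1 := abs_integral_inner_le hu.memLp_grad (hv.memLp_grad.sub hψL')
    have i2 := abs_integral_inner_le hu.memLp (hv.memLp.sub hψL)
    have e1 : ∫ x in ω, inner ℝ (G x) ((H - gradient ψ) x) =
        (∫ x in ω, inner ℝ (G x) (H x)) - ∫ x in ω, inner ℝ (G x) (gradient ψ x) := by
      rw [← integral_sub (integrable_inner hu.memLp_grad hv.memLp_grad)
        (integrable_inner hu.memLp_grad hψL')]
      simp [inner_sub_right]
    have e2 : ∫ x in ω, inner ℝ (u x) ((v - ψ) x) =
        (∫ x in ω, u x * v x) - ∫ x in ω, u x * ψ x := by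
      have j1 := integrable_inner hu.memLp hv.memLp
      have j2 := integrable_inner hu.memLp hψL
      simp only [RCLike.inner_apply, conj_trivial, mul_comm] at j1 j2
      rw [← integral_sub j1 j2]
      simp [mul_sub, mul_comm]
    rw [e1, h ψ hψ] at i1
    rw [e2] at i2
    have k1 : (eLpNorm (H - gradient ψ) 2 (volume.restrict ω)).toReal ≤ ε :=
      ENNReal.toReal_le_of_le_ofReal hε.le h2.le
    have k2 : (eLpNorm (v - ψ) 2 (volume.restrict ω)).toReal ≤ ε :=
      ENNReal.toReal_le_of_le_ofReal hε.le h1.le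
    have l1 := i1.trans (mul_le_mul_of_nonneg_left k1 ENNReal.toReal_nonneg)
    have l2 := i2.trans (mul_le_mul_of_nonneg_left k2 ENNReal.toReal_nonneg)
    calc |(∫ x in ω, inner ℝ (G x) (H x)) - μ * ∫ x in ω, u x * v x|
        = |((∫ x in ω, inner ℝ (G x) (H x)) - μ * ∫ x in ω, u x * ψ x) -
          μ * ((∫ x in ω, u x * v x) - ∫ x in ω, u x * ψ x)| := by congr 1; ring
      _ ≤ _ := abs_sub _ _
      _ ≤ a * ε + |μ| * (c * ε) := by
          rw [abs_mul]
          exact add_le_add l1 (mul_le_mul_of_nonneg_left l2 (abs_nonneg _))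
      _ = (a + |μ| * c) * ε := by ring
  have hK : 0 ≤ a + |μ| * c := by positivity
  rw [← sub_eq_zero, ← abs_nonpos_iff]
  refine le_of_forall_pos_le_add fun ε hε => ?_
  have := key (ε / (a + |μ| * c + 1)) (by positivity)
  refine this.trans ?_
  rw [zero_add, mul_div_assoc', div_le_iff₀ (by positivity)]
  nlinarith

/-- Testing each equation with the other eigenfunction gives the same Dirichlet form twice. -/
lemma integral_mul_eq_zero_of_ne (hω : IsOpen ω) (hb : Bornology.IsBounded ω) {u v : Eucl d → ℝ}
    {μ ν : ℝ} (hu : InDirichletEigenspace ω μ u) (hv : InDirichletEigenspace ω ν v) (h : μ ≠ ν) :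
    ∫ x in ω, u x * v x = 0 := by
  obtain ⟨G, hG, hG'⟩ := hu
  obtain ⟨H, hH, hH'⟩ := hv
  have h1 := weak_eigen_extend hω hb hG hH hG'
  have h2 := weak_eigen_extend hω hb hH hG hH'
  simp only [real_inner_comm, mul_comm (v _)] at h1 h2
  rw [h1] at h2
  have h3 : (μ - ν) * ∫ x in ω, u x * v x = 0 := by linarith
  exact (mul_eq_zero.1 h3).resolve_left (sub_ne_zero.2 h)

end H10

/-! ### The Dirichlet modes of an orthotope -/

lemma contDiff_sineMode (r : ℝ) (k : ℕ) : ContDiff ℝ (⊤ : ℕ∞) (sineMode r k) :=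
  contDiff_const.mul (Real.contDiff_sin.comp (contDiff_const.mul contDiff_id))

lemma deriv_deriv_sineMode (r : ℝ) (k : ℕ) :
    deriv (deriv (sineMode r k)) =
      fun t => -(((k : ℝ) + 1) * Real.pi / r) ^ 2 * sineMode r k t := by
  set a := ((k : ℝ) + 1) * Real.pi / r with ha
  have h1 : ∀ t, HasDerivAt (sineMode r k) (√(2 / r) * (Real.cos (a * t) * a)) t := by
    intro t
    have := ((Real.hasDerivAt_sin (a * t)).comp t ((hasDerivAt_id t).const_mul a)).const_mul
      √(2 / r)
    have e : sineMode r k = fun t => √(2 / r) * Real.sin (a * t) := rfl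
    rw [e]
    simpa [Function.comp_def] using this
  have h2 : deriv (sineMode r k) = fun t => √(2 / r) * (Real.cos (a * t) * a) :=
    funext fun t => (h1 t).deriv
  rw [h2]
  funext t
  have := (((Real.hasDerivAt_cos (a * t)).comp t
    ((hasDerivAt_id t).const_mul a)).mul_const a).const_mul √(2 / r)
  rw [HasDerivAt.deriv (f' := √(2 / r) * (-Real.sin (a * t) * a * a))]
  · simp only [sineMode, ← ha]; ring
  · simpa [Function.comp_def] using this

/-- Behind the domination of every mode by the lowest one, as `memH10_of_abs_le` requires. -/
lemma abs_sin_nat_succ_mul_le (k : ℕ) (θ : ℝ) :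
    |Real.sin (((k : ℝ) + 1) * θ)| ≤ ((k : ℝ) + 1) * |Real.sin θ| := by
  induction k with
  | zero => simp
  | succ k ih =>
    push_cast
    rw [show ((k : ℝ) + 1 + 1) * θ = ((k : ℝ) + 1) * θ + θ by ring, Real.sin_add]
    calc _ ≤ |Real.sin (((k : ℝ) + 1) * θ) * Real.cos θ| +
          |Real.cos (((k : ℝ) + 1) * θ) * Real.sin θ| := abs_add_le _ _
      _ ≤ |Real.sin (((k : ℝ) + 1) * θ)| * 1 + 1 * |Real.sin θ| := by
          rw [abs_mul, abs_mul]
          gcongr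
          · exact Real.abs_cos_le_one _
          · exact Real.abs_cos_le_one _
      _ ≤ _ := by linarith

lemma abs_sineMode_le (r : ℝ) (k : ℕ) (t : ℝ) :
    |sineMode r k t| ≤ ((k : ℝ) + 1) * |sineMode r 0 t| := by
  have := abs_sin_nat_succ_mul_le k (Real.pi / r * t)
  rw [sineMode, sineMode, abs_mul, abs_mul]
  have e1 : ((k : ℝ) + 1) * Real.pi / r * t = ((k : ℝ) + 1) * (Real.pi / r * t) := by ring
  have e2 : (((0 : ℕ) : ℝ) + 1) * Real.pi / r * t = Real.pi / r * t := by push_cast; ring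
  rw [e1, e2]
  calc _ ≤ |√(2 / r)| * (((k : ℝ) + 1) * |Real.sin (Real.pi / r * t)|) := by gcongr
    _ = _ := by ring

lemma sineMode_zero_pos {r t : ℝ} (ht : t ∈ Ioo 0 r) : 0 < sineMode r 0 t := by
  have hr : 0 < r := ht.1.trans ht.2
  refine mul_pos (by positivity) (Real.sin_pos_of_pos_of_lt_pi ?_ ?_)
  · have := ht.1; have := Real.pi_pos; positivity
  · push_cast
    rw [zero_add, one_mul, div_mul_eq_mul_div, div_lt_iff₀ hr]
    exact mul_lt_mul_of_pos_left ht.2 Real.pi_pos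

lemma sineMode_zero_right {r : ℝ} (k : ℕ) : sineMode r k 0 = 0 := by simp [sineMode]

lemma sineMode_self {r : ℝ} (hr : 0 < r) (k : ℕ) : sineMode r k r = 0 := by
  have := sin_int_mul_pi_div hr (k + 1)
  push_cast at this
  rw [sineMode, this, mul_zero]

/-- Multiplication by this cosine moves a mode to its two neighbours, so it preserves the span of
the modes; completeness rests on this. -/
lemma cos_mul_sineMode (r : ℝ) (k : ℕ) (t : ℝ) :
    Real.cos (Real.pi / r * t) * sineMode r (k + 1) t =
      2⁻¹ * sineMode r (k + 2) t + 2⁻¹ * sineMode r k t := by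
  simp only [sineMode]
  push_cast
  rw [show ((k : ℝ) + 2 + 1) * Real.pi / r * t =
      ((k : ℝ) + 1 + 1) * Real.pi / r * t + Real.pi / r * t by ring,
    show ((k : ℝ) + 1) * Real.pi / r * t =
      ((k : ℝ) + 1 + 1) * Real.pi / r * t - Real.pi / r * t by ring, Real.sin_add, Real.sin_sub]
  ring

lemma cos_mul_sineMode_zero (r : ℝ) (t : ℝ) :
    Real.cos (Real.pi / r * t) * sineMode r 0 t = 2⁻¹ * sineMode r 1 t := by
  simp only [sineMode]
  push_cast
  rw [show ((1 : ℝ) + 1) * Real.pi / r * t = 2 * (Real.pi / r * t) by ring,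
    show ((0 : ℝ) + 1) * Real.pi / r * t = Real.pi / r * t by ring, Real.sin_two_mul]
  ring

lemma abs_sineMode_le_sqrt (r : ℝ) (k : ℕ) (t : ℝ) : |sineMode r k t| ≤ √(2 / r) := by
  rw [sineMode, abs_mul, abs_of_nonneg (Real.sqrt_nonneg _)]
  exact mul_le_of_le_one_right (Real.sqrt_nonneg _) (Real.abs_sin_le_one _)

section BoxMode

variable {d : ℕ} (b : OrthonormalBasis (Fin d) ℝ (Eucl d)) (c : Eucl d)

/-- The tensor product of functions of the coordinates of an orthotope. -/
noncomputable def boxProd (F : Fin d → ℝ → ℝ) (x : Eucl d) : ℝ :=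
  ∏ i, F i (inner ℝ (b i) (x - c))

lemma contDiff_boxProd {F : Fin d → ℝ → ℝ} (hF : ∀ i, ContDiff ℝ (⊤ : ℕ∞) (F i)) :
    ContDiff ℝ (⊤ : ℕ∞) (boxProd b c F) :=
  contDiff_prod fun i _ => (hF i).comp (contDiff_const.inner ℝ (contDiff_id.sub contDiff_const))

/-- A displacement along `b i` changes only the `i`-th coordinate, so only one factor is
differentiated. -/
lemma fderiv_boxProd {F : Fin d → ℝ → ℝ} (hF : ∀ i, ContDiff ℝ (⊤ : ℕ∞) (F i)) (i : Fin d)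
    (x : Eucl d) : fderiv ℝ (boxProd b c F) x (b i) =
      boxProd b c (Function.update F i (deriv (F i))) x := by
  have hdiff : DifferentiableAt ℝ (boxProd b c F) x :=
    (contDiff_boxProd b c hF).differentiable (by simp) x
  rw [← hdiff.lineDeriv_eq_fderiv]
  have hline : (fun t : ℝ => boxProd b c F (x + t • b i)) = fun t =>
      F i (inner ℝ (b i) (x - c) + t) * ∏ j ∈ Finset.univ.erase i, F j (inner ℝ (b j) (x - c)) := by
    funext t
    rw [boxProd, ← Finset.mul_prod_erase _ _ (Finset.mem_univ i)]
    congr 1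
    · congr 1
      rw [add_sub_right_comm, inner_add_right, inner_smul_right]
      simp
    · refine Finset.prod_congr rfl fun j hj => ?_
      rw [add_sub_right_comm, inner_add_right, inner_smul_right,
        b.inner_eq_zero (Finset.ne_of_mem_erase hj), mul_zero, add_zero]
  rw [lineDeriv, hline, boxProd, ← Finset.mul_prod_erase _ _ (Finset.mem_univ i)]
  have h1 : HasDerivAt (fun t => F i (inner ℝ (b i) (x - c) + t))
      (deriv (F i) (inner ℝ (b i) (x - c))) 0 := by
    have h2 : HasDerivAt (F i) (deriv (F i) (inner ℝ (b i) (x - c))) (inner ℝ (b i) (x - c) + 0) := by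
      rw [add_zero]
      exact ((hF i).differentiable (by simp) _).hasDerivAt
    exact h2.comp_const_add _ _
  rw [(h1.mul_const _).deriv]
  congr 1
  · simp
  · refine Finset.prod_congr rfl fun j hj => ?_
    rw [Function.update_of_ne (Finset.ne_of_mem_erase hj)]

variable (r : Fin d → ℝ)

/-- The Dirichlet eigenfunctions of an orthotope. -/
noncomputable def boxMode (k : Fin d → ℕ) : Eucl d → ℝ :=
  boxProd b c fun i => sineMode (r i) (k i)

/-- The Dirichlet eigenvalues of an orthotope. -/
noncomputable def boxEigenvalue {d : ℕ} (r : Fin d → ℝ) (k : Fin d → ℕ) : ℝ :=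
  ∑ i, (((k i : ℝ) + 1) * Real.pi / r i) ^ 2

lemma contDiff_boxMode (k : Fin d → ℕ) : ContDiff ℝ (⊤ : ℕ∞) (boxMode b c r k) :=
  contDiff_boxProd b c fun _ => contDiff_sineMode _ _

lemma laplacian_boxMode (k : Fin d → ℕ) (x : Eucl d) :
    ∑ i, fderiv ℝ (fun y => fderiv ℝ (boxMode b c r k) y (b i)) x (b i) =
      -boxEigenvalue r k * boxMode b c r k x := by
  rw [boxEigenvalue, ← Finset.sum_neg_distrib, Finset.sum_mul]
  refine Finset.sum_congr rfl fun i _ => ?_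
  have hF : ∀ i, ContDiff ℝ (⊤ : ℕ∞) (sineMode (r i) (k i)) := fun i => contDiff_sineMode _ _
  have h1 : (fun y => fderiv ℝ (boxMode b c r k) y (b i)) = boxProd b c
      (Function.update (fun i => sineMode (r i) (k i)) i (deriv (sineMode (r i) (k i)))) :=
    funext fun y => fderiv_boxProd b c hF i y
  rw [h1, fderiv_boxProd]
  · rw [Function.update_idem, Function.update_self, deriv_deriv_sineMode, boxMode, boxProd, boxProd,
      ← Finset.mul_prod_erase _ _ (Finset.mem_univ i),
      ← Finset.mul_prod_erase (a := i) _ (fun i => sineMode (r i) (k i) _) (Finset.mem_univ i),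
      Function.update_self, mul_assoc]
    congr 2
    refine Finset.prod_congr rfl fun j hj => ?_
    rw [Function.update_of_ne (Finset.ne_of_mem_erase hj)]
  · intro j
    by_cases hj : j = i
    · subst hj
      rw [Function.update_self]
      exact (hF j).deriv'
    · rw [Function.update_of_ne hj]
      exact hF j

lemma boxMode_zero_pos {x : Eucl d} (hx : x ∈ box b c r) : 0 < boxMode b c r 0 x := by
  rw [boxMode, boxProd]
  exact Finset.prod_pos fun i _ => sineMode_zero_pos (hx i)

variable {r}

lemma boxMode_eq_zero (hr : ∀ i, 0 < r i) {x : Eucl d} (hx : x ∈ closure (box b c r))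
    (hx' : x ∉ box b c r) (k : Fin d → ℕ) : boxMode b c r k x = 0 := by
  have h := closure_box_subset b c hx
  simp only [box, mem_ofPred_eq, not_forall] at hx'
  obtain ⟨i, hi⟩ := hx'
  refine Finset.prod_eq_zero (Finset.mem_univ i) ?_
  have h1 := (h i)
  rcases h1.1.eq_or_lt with h0 | h0
  · simp only [← h0, sineMode_zero_right]
  · rcases h1.2.eq_or_lt with h2 | h2
    · simp only [h2, sineMode_self (hr i)]
    · exact absurd ⟨h0, h2⟩ hi

lemma abs_boxMode_le (k : Fin d → ℕ) {x : Eucl d} (hx : x ∈ box b c r) :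
    |boxMode b c r k x| ≤ (∏ i, ((k i : ℝ) + 1)) * boxMode b c r 0 x := by
  rw [boxMode, boxMode, boxProd, boxProd, Finset.abs_prod, ← Finset.prod_mul_distrib]
  refine Finset.prod_le_prod (fun i _ => abs_nonneg _) fun i _ => ?_
  refine (abs_sineMode_le _ _ _).trans (le_of_eq ?_)
  rw [abs_of_pos]
  · rfl
  · exact sineMode_zero_pos (hx i)

lemma inDirichletEigenspace_boxMode (hr : ∀ i, 0 < r i) (k : Fin d → ℕ) :
    InDirichletEigenspace (box b c r) (boxEigenvalue r k) (boxMode b c r k) := by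
  have hω := isOpen_box b c (r := r)
  have hb := isBounded_box b c (r := r)
  refine ⟨gradient (boxMode b c r k), memH10_of_abs_le hω hb (contDiff_boxMode b c r k)
    (contDiff_boxMode b c r 0) (fun x hx hx' => boxMode_eq_zero b c hr hx hx' 0)
    (fun x hx => boxMode_zero_pos b c r hx) (C := ∏ i, ((k i : ℝ) + 1))
    (Finset.prod_nonneg fun i _ => by positivity) (fun x hx => abs_boxMode_le b c k hx), ?_⟩
  intro ψ hψ
  exact weak_eigen_of_smooth hω hb b (contDiff_boxMode b c r k) (laplacian_boxMode b c r k) hψ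

lemma memLp_boxMode (k : Fin d → ℕ) :
    MemLp (boxMode b c r k) 2 (volume.restrict (box b c r)) :=
  memLp_of_continuous (contDiff_boxMode b c r k).continuous (isOpen_box b c) (isBounded_box b c) 2

lemma integral_boxMode_mul (hr : ∀ i, 0 < r i) (k m : Fin d → ℕ) :
    ∫ x in box b c r, boxMode b c r k x * boxMode b c r m x = if k = m then 1 else 0 := by
  simp only [boxMode, boxProd, ← Finset.prod_mul_distrib]
  rw [setIntegral_box_prod b c fun i t => sineMode (r i) (k i) t * sineMode (r i) (m i) t]
  simp_rw [integral_sineMode_mul (hr _)]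
  split_ifs with h
  · simp [h]
  · obtain ⟨i, hi⟩ := Function.ne_iff.1 h
    exact Finset.prod_eq_zero (Finset.mem_univ i) (by simp [hi])

lemma integral_inner_boxMode_mul (hr : ∀ i, 0 < r i) (k m : Fin d → ℕ) (j : Fin d) :
    ∫ x in box b c r, inner ℝ (b j) (x - c) * (boxMode b c r k x * boxMode b c r m x) =
      (∫ t in Ioo 0 (r j), t * (sineMode (r j) (k j) t * sineMode (r j) (m j) t)) *
        ∏ i ∈ Finset.univ.erase j, if k i = m i then 1 else 0 := by
  have e : ∀ x, inner ℝ (b j) (x - c) * (boxMode b c r k x * boxMode b c r m x) =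
      ∏ i, (fun i t => (if i = j then t else 1) * (sineMode (r i) (k i) t * sineMode (r i) (m i) t))
        i (inner ℝ (b i) (x - c)) := by
    intro x
    simp only [boxMode, boxProd, Finset.prod_mul_distrib]
    simp
  simp_rw [e]
  rw [setIntegral_box_prod b c fun i t =>
      (if i = j then t else 1) * (sineMode (r i) (k i) t * sineMode (r i) (m i) t), ← Finset.mul_prod_erase _ _ (Finset.mem_univ j)]
  congr 1
  · simp
  · refine Finset.prod_congr rfl fun i hi => ?_
    simp only [Finset.ne_of_mem_erase hi, if_false, one_mul]
    exact integral_sineMode_mul (hr i) _ _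

/-- With `g` expanded in the frame, a component `j ≠ i` contributes nothing, because the factors in
direction `i` are orthogonal. -/
lemma integral_inner_boxMode_mul_of_adj (hr : ∀ i, 0 < r i) {k m : Fin d → ℕ} {i : Fin d}
    (h1 : ∀ j, j ≠ i → k j = m j) (h2 : k i + 1 = m i ∨ m i + 1 = k i) (g : Eucl d) :
    ∃ C, 16 / 9 ≤ C ∧
    ∫ x in box b c r, inner ℝ g (x - c) * (boxMode b c r k x * boxMode b c r m x) =
      -(inner ℝ (b i) g * (r i / Real.pi ^ 2 * C)) := by
  obtain ⟨C, hC, hCi⟩ := integral_mul_sineMode_succ (hr i) (k i) (m i) h2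
  refine ⟨C, hC, ?_⟩
  have hcont : ∀ j, Continuous fun x : Eucl d =>
      inner ℝ (b j) (x - c) * (boxMode b c r k x * boxMode b c r m x) := fun j =>
    (by fun_prop : Continuous fun x : Eucl d => (inner ℝ (b j) (x - c) : ℝ)).mul
      ((contDiff_boxMode b c r k).continuous.mul (contDiff_boxMode b c r m).continuous)
  have e : ∀ x, inner ℝ g (x - c) * (boxMode b c r k x * boxMode b c r m x) =
      ∑ j, inner ℝ (b j) g *
        (inner ℝ (b j) (x - c) * (boxMode b c r k x * boxMode b c r m x)) := by
    intro x
    rw [← b.sum_inner_mul_inner, Finset.sum_mul]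
    refine Finset.sum_congr rfl fun j _ => ?_
    rw [real_inner_comm]
    ring
  have hint : ∀ j ∈ Finset.univ, IntegrableOn (fun x => inner ℝ (b j) g *
        (inner ℝ (b j) (x - c) * (boxMode b c r k x * boxMode b c r m x))) (box b c r) := fun j _ =>
    memLp_one_iff_integrable.1 (memLp_of_continuous (continuous_const.mul (hcont j))
      (isOpen_box b c) (isBounded_box b c) 1)
  simp_rw [e]
  rw [integral_finsetSum _ hint]
  simp_rw [integral_const_mul, integral_inner_boxMode_mul b c hr]
  rw [Finset.sum_eq_single i]
  · rw [hCi, Finset.prod_eq_one fun j hj => by rw [if_pos (h1 j (Finset.ne_of_mem_erase hj))]]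
    ring
  · intro j _ hj
    rw [Finset.prod_eq_zero (i := i)]
    · simp
    · simp [Ne.symm hj]
    · rw [if_neg]; omega
  · simp

lemma abs_boxMode_mul_le (hr : ∀ i, 0 < r i) (k m : Fin d → ℕ) (x : Eucl d) :
    |boxMode b c r k x * boxMode b c r m x| ≤ ∏ i, (2 / r i) := by
  rw [boxMode, boxMode, boxProd, boxProd, ← Finset.prod_mul_distrib, Finset.abs_prod]
  refine Finset.prod_le_prod (fun i _ => abs_nonneg _) fun i _ => ?_
  rw [abs_mul]
  have hs : √(2 / r i) * √(2 / r i) = 2 / r i := Real.mul_self_sqrt (by have := hr i; positivity)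
  rw [← hs]
  exact mul_le_mul (abs_sineMode_le_sqrt _ _ _) (abs_sineMode_le_sqrt _ _ _) (abs_nonneg _)
    (Real.sqrt_nonneg _)

/-! ### Completeness of the modes -/

lemma cos_mul_boxMode_mem_span (i : Fin d) (k : Fin d → ℕ) :
    (fun x => Real.cos (Real.pi / r i * inner ℝ (b i) (x - c)) * boxMode b c r k x) ∈
      Submodule.span ℝ (range (boxMode b c r)) := by
  have hsplit : ∀ (n : ℕ) (x : Eucl d), boxMode b c r (Function.update k i n) x =
      sineMode (r i) n (inner ℝ (b i) (x - c)) *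
        ∏ j ∈ Finset.univ.erase i, sineMode (r j) (k j) (inner ℝ (b j) (x - c)) := by
    intro n x
    rw [boxMode, boxProd, ← Finset.mul_prod_erase _ _ (Finset.mem_univ i), Function.update_self]
    congr 1
    refine Finset.prod_congr rfl fun j hj => ?_
    rw [Function.update_of_ne (Finset.ne_of_mem_erase hj)]
  have hmem : ∀ n, boxMode b c r (Function.update k i n) ∈
      Submodule.span ℝ (range (boxMode b c r)) := fun n => Submodule.subset_span ⟨_, rfl⟩
  have hk : ∀ x, boxMode b c r k x = boxMode b c r (Function.update k i (k i)) x := by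
    intro x; rw [Function.update_eq_self]
  rcases Nat.eq_zero_or_pos (k i) with h0 | h0
  · convert! Submodule.smul_mem _ (2⁻¹ : ℝ) (hmem 1) using 1
    funext x
    rw [hk, Pi.smul_apply, hsplit, hsplit, h0, smul_eq_mul, ← mul_assoc, cos_mul_sineMode_zero]
    ring
  · obtain ⟨n, hn⟩ := Nat.exists_eq_succ_of_ne_zero h0.ne'
    convert! Submodule.add_mem _ (Submodule.smul_mem _ (2⁻¹ : ℝ) (hmem (n + 2)))
      (Submodule.smul_mem _ (2⁻¹ : ℝ) (hmem n)) using 1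
    funext x
    rw [hk, Pi.add_apply, Pi.smul_apply, Pi.smul_apply, hsplit, hsplit, hsplit, hn, smul_eq_mul,
      smul_eq_mul, ← mul_assoc, Nat.succ_eq_add_one, cos_mul_sineMode]
    ring

/-- The functions `cos (π yᵢ / rᵢ)` of the coordinates `yᵢ` of an orthotope. -/
noncomputable def boxCos (r : Fin d → ℝ) (i : Fin d) : C(Eucl d, ℝ) where
  toFun x := Real.cos (Real.pi / r i * inner ℝ (b i) (x - c))
  continuous_toFun := by fun_prop

/-- The span of the modes is a module over the algebra generated by the cosines. -/
lemma mul_mem_span_of_mem_adjoin {p : C(Eucl d, ℝ)}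
    (hp : p ∈ Algebra.adjoin ℝ (range (boxCos b c r))) {m : Eucl d → ℝ}
    (hm : m ∈ Submodule.span ℝ (range (boxMode b c r))) :
    (fun x => p x * m x) ∈ Submodule.span ℝ (range (boxMode b c r)) := by
  induction hp using Algebra.adjoin_induction generalizing m with
  | mem p hp =>
    obtain ⟨i, rfl⟩ := hp
    induction hm using Submodule.span_induction with
    | mem m hm =>
      obtain ⟨k, rfl⟩ := hm
      exact cos_mul_boxMode_mem_span b c i k
    | zero =>
      convert! Submodule.zero_mem (Submodule.span ℝ (range (boxMode b c r))) using 1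
      funext x; simp
    | add m n _ _ h1 h2 =>
      convert! Submodule.add_mem _ h1 h2 using 1
      funext x; simp; ring
    | smul a m _ h =>
      convert! Submodule.smul_mem _ a h using 1
      funext x; simp; ring
  | algebraMap a =>
    convert! Submodule.smul_mem _ a hm using 1
  | add p q _ _ h1 h2 =>
    convert! Submodule.add_mem _ (h1 hm) (h2 hm) using 1
    funext x; simp; ring
  | mul p q _ _ h1 h2 =>
    convert! h1 (h2 hm) using 1
    funext x; simp; ring

/-- Stone–Weierstrass on the closed box: the cosines separate points because cosine is injective on
`[0, π]`. -/
lemma exists_adjoin_near (hr : ∀ i, 0 < r i) {g : Eucl d → ℝ} (hg : Continuous g) {ε : ℝ}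
    (hε : 0 < ε) : ∃ p ∈ Algebra.adjoin ℝ (range (boxCos b c r)),
      ∀ x ∈ box b c r, |p x - g x| ≤ ε := by
  set K := closure (box b c r) with hK
  have : CompactSpace K := isCompact_iff_compactSpace.1 (isBounded_box b c).isCompact_closure
  set ι : C(K, Eucl d) := ⟨Subtype.val, continuous_subtype_val⟩ with hι
  set A := (Algebra.adjoin ℝ (range (boxCos b c r))).map (ContinuousMap.compRightAlgHom ℝ ℝ ι)
    with hA
  have hsep : A.SeparatesPoints := by
    rintro ⟨x, hx⟩ ⟨y, hy⟩ hxy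
    have hx' := closure_box_subset b c hx
    have hy' := closure_box_subset b c hy
    have hne : ∃ i, (inner ℝ (b i) (x - c) : ℝ) ≠ inner ℝ (b i) (y - c) := by
      by_contra! hcon
      apply hxy
      have : x - c = y - c := b.repr.injective (by
        ext i; rw [b.repr_apply_apply, b.repr_apply_apply, hcon i])
      simpa using this
    obtain ⟨i, hi⟩ := hne
    refine ⟨_, ⟨ContinuousMap.compRightAlgHom ℝ ℝ ι (boxCos b c r i),
      ⟨_, Algebra.subset_adjoin ⟨i, rfl⟩, rfl⟩, rfl⟩, ?_⟩
    intro heq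
    change Real.cos (Real.pi / r i * inner ℝ (b i) (x - c)) =
      Real.cos (Real.pi / r i * inner ℝ (b i) (y - c)) at heq
    have hpr : 0 < Real.pi / r i := div_pos Real.pi_pos (hr i)
    have hmem : ∀ t ∈ Icc 0 (r i), Real.pi / r i * t ∈ Icc 0 Real.pi := by
      intro t ht
      refine ⟨mul_nonneg hpr.le ht.1, ?_⟩
      calc Real.pi / r i * t ≤ Real.pi / r i * r i := by gcongr; exact ht.2
        _ = Real.pi := div_mul_cancel₀ _ (hr i).ne'
    have := Real.injOn_cos (hmem _ (hx' i)) (hmem _ (hy' i)) heq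
    exact hi (mul_left_cancel₀ hpr.ne' this)
  obtain ⟨⟨q, hq⟩, hqg⟩ := ContinuousMap.exists_mem_subalgebra_near_continuousMap_of_separatesPoints
    A hsep ⟨fun x : K => g x, hg.comp continuous_subtype_val⟩ ε hε
  obtain ⟨p, hp, rfl⟩ := hq
  refine ⟨p, hp, fun x hx => ?_⟩
  have := (ContinuousMap.norm_coe_le_norm _ (⟨x, subset_closure hx⟩ : K)).trans hqg.le
  exact this

lemma integral_mul_eq_zero_of_mem_span {f : Eucl d → ℝ}
    (hf : MemLp f 2 (volume.restrict (box b c r)))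
    (h0 : ∀ k, ∫ x in box b c r, f x * boxMode b c r k x = 0) {m : Eucl d → ℝ}
    (hm : m ∈ Submodule.span ℝ (range (boxMode b c r))) :
    Continuous m ∧ ∫ x in box b c r, f x * m x = 0 := by
  have hint : ∀ m : Eucl d → ℝ, Continuous m → IntegrableOn (fun x => f x * m x) (box b c r) := by
    intro m hm
    have := integrable_inner hf (memLp_of_continuous hm (isOpen_box b c) (isBounded_box b c) 2)
    rw [IntegrableOn]
    simpa only [RCLike.inner_apply, conj_trivial, mul_comm] using this
  induction hm using Submodule.span_induction with
  | mem m hm =>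
    obtain ⟨k, rfl⟩ := hm
    exact ⟨(contDiff_boxMode b c r k).continuous, h0 k⟩
  | zero => exact ⟨continuous_zero, by simp⟩
  | add m n _ _ h1 h2 =>
    refine ⟨h1.1.add h2.1, ?_⟩
    simp only [Pi.add_apply, mul_add]
    rw [integral_add (hint m h1.1) (hint n h2.1), h1.2, h2.2, add_zero]
  | smul a m _ h =>
    refine ⟨h.1.const_smul a, ?_⟩
    simp only [Pi.smul_apply, smul_eq_mul, mul_left_comm]
    rw [integral_const_mul, h.2, mul_zero]

/-- The Dirichlet modes of an orthotope are complete. -/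
theorem ae_eq_zero_of_integral_boxMode (hr : ∀ i, 0 < r i) {f : Eucl d → ℝ}
    (hf : MemLp f 2 (volume.restrict (box b c r)))
    (h0 : ∀ k, ∫ x in box b c r, f x * boxMode b c r k x = 0) :
    ∀ᵐ x ∂(volume.restrict (box b c r)), f x = 0 := by
  have hω := isOpen_box b c (r := r)
  have hint : ∀ m : Eucl d → ℝ, Continuous m → IntegrableOn (fun x => f x * m x) (box b c r) := by
    intro m hm
    have := integrable_inner hf (memLp_of_continuous hm (isOpen_box b c) (isBounded_box b c) 2)
    rw [IntegrableOn]
    simpa only [RCLike.inner_apply, conj_trivial, mul_comm] using this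
  set w := boxMode b c r 0 with hw
  have hwc : Continuous w := (contDiff_boxMode b c r 0).continuous
  have hF := hint w hwc
  -- For `p` in the algebra of cosines, `p * w` lies in the span of the modes, so `f * w` is
  -- orthogonal to `p`, and uniform approximation extends this to every continuous `g`. Since the
  -- lowest mode `w` is positive in the box, `f` vanishes with `f * w`.
  have hkey : ∀ g : Eucl d → ℝ, Continuous g → ∫ x in box b c r, f x * w x * g x = 0 := by
    intro g hg
    set I := ∫ x in box b c r, |f x * w x| with hI
    have hI0 : 0 ≤ I := integral_nonneg fun x => abs_nonneg _
    rw [← abs_nonpos_iff]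
    refine le_of_forall_pos_le_add fun ε hε => ?_
    obtain ⟨p, hp, hpg⟩ := exists_adjoin_near b c hr hg (ε := ε / (I + 1)) (by positivity)
    have h1 := (integral_mul_eq_zero_of_mem_span b c hf h0 (mul_mem_span_of_mem_adjoin b c hp
      (Submodule.subset_span ⟨0, rfl⟩))).2
    have hi1 : IntegrableOn (fun x => f x * w x * g x) (box b c r) := by
      simpa only [mul_assoc] using hint (fun x => w x * g x) (hwc.mul hg)
    have hi2 : IntegrableOn (fun x => f x * (p x * w x)) (box b c r) :=
      hint _ (p.continuous.mul hwc)
    have h2 : ∫ x in box b c r, f x * w x * g x =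
        ∫ x in box b c r, (f x * w x * g x - f x * (p x * w x)) := by
      rw [integral_sub hi1 hi2, h1, sub_zero]
    rw [h2, zero_add]
    calc |∫ x in box b c r, (f x * w x * g x - f x * (p x * w x))|
        ≤ ∫ x in box b c r, |f x * w x * g x - f x * (p x * w x)| := abs_integral_le_integral_abs
      _ ≤ ∫ x in box b c r, |f x * w x| * (ε / (I + 1)) := by
          refine setIntegral_mono_on (hi1.sub hi2).abs (hF.abs.mul_const _) hω.measurableSet
            fun x hx => ?_
          rw [show f x * w x * g x - f x * (p x * w x) = f x * w x * (g x - p x) by ring, abs_mul,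
            abs_sub_comm]
          gcongr
          exact hpg x hx
      _ = I * (ε / (I + 1)) := integral_mul_const _ _
      _ ≤ ε := by
          rw [mul_div_assoc', div_le_iff₀ (by positivity)]
          nlinarith
  have hae := hω.ae_eq_zero_of_integral_contDiff_smul_eq_zero (f := fun x => f x * w x)
    hF.locallyIntegrableOn (fun g hg _ hgs => by
      rw [← setIntegral_eq_integral_of_forall_compl_eq_zero (s := box b c r)]
      · simpa only [smul_eq_mul, mul_comm (g _)] using hkey g hg.continuous
      · intro x hx
        rw [image_eq_zero_of_notMem_tsupport fun h => hx (hgs h), zero_smul])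
  rw [ae_restrict_iff' hω.measurableSet]
  filter_upwards [hae] with x hx hxω
  exact (mul_eq_zero.1 (hx hxω)).resolve_right (boxMode_zero_pos b c r hxω).ne'

end BoxMode

/-! ### The Dirichlet spectrum of an orthotope -/

/-- Needed because elements of a Hilbert basis are classes, whose representatives need not be the
smooth modes themselves. -/
lemma InDirichletEigenspace.congr_ae {d : ℕ} {ω : Set (Eucl d)} {μ : ℝ} {u v : Eucl d → ℝ}
    (hu : InDirichletEigenspace ω μ u) (h : u =ᵐ[volume.restrict ω] v) :
    InDirichletEigenspace ω μ v := by
  obtain ⟨G, hG, hG'⟩ := hu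
  refine ⟨G, ⟨(memLp_congr_ae h).1 hG.memLp, hG.memLp_grad, fun ψ hψ => ?_, fun ε hε => ?_⟩,
    fun ψ hψ => ?_⟩
  · rw [← hG.hasWeakGradientOn ψ hψ]
    refine integral_congr_ae ?_
    filter_upwards [h] with x hx
    rw [hx]
  · obtain ⟨ψ, hψ, h1, h2⟩ := hG.approx ε hε
    refine ⟨ψ, hψ, ?_, h2⟩
    rwa [eLpNorm_congr_ae (g := fun x => u x - ψ x)]
    filter_upwards [h] with x hx
    rw [hx]
  · rw [hG' ψ hψ]
    congr 1
    refine integral_congr_ae ?_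
    filter_upwards [h] with x hx
    rw [hx]

lemma InDirichletEigenspace.memLp {d : ℕ} {ω : Set (Eucl d)} {μ : ℝ} {u : Eucl d → ℝ}
    (hu : InDirichletEigenspace ω μ u) : MemLp u 2 (volume.restrict ω) := by
  obtain ⟨G, hG, -⟩ := hu
  exact hG.memLp

lemma finite_boxEigenvalue_le {d : ℕ} {r : Fin d → ℝ} (hr : ∀ i, 0 < r i) (M : ℝ) :
    {k | boxEigenvalue r k ≤ M}.Finite := by
  obtain ⟨B, hB⟩ : ∃ B : ℕ, ∀ i, √M * r i / Real.pi ≤ B := by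
    choose f hf using fun i => exists_nat_ge (√M * r i / Real.pi)
    refine ⟨∑ i, f i, fun i => (hf i).trans ?_⟩
    exact_mod_cast Finset.single_le_sum (fun j _ => Nat.zero_le (f j)) (Finset.mem_univ i)
  refine (Set.finite_Iic (fun _ : Fin d => B)).subset fun k hk i => ?_
  have h1 : (((k i : ℝ) + 1) * Real.pi / r i) ^ 2 ≤ M := by
    refine le_trans ?_ hk
    exact Finset.single_le_sum (f := fun i => (((k i : ℝ) + 1) * Real.pi / r i) ^ 2)
      (fun j _ => sq_nonneg _) (Finset.mem_univ i)
  have h2 := Real.le_sqrt_of_sq_le h1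
  have h3 : (k i : ℝ) + 1 ≤ √M * r i / Real.pi := by
    rw [le_div_iff₀ Real.pi_pos]
    rwa [div_le_iff₀ (hr i)] at h2
  have h4 : (k i : ℝ) + 1 ≤ B := h3.trans (hB i)
  have h5 : k i + 1 ≤ B := by exact_mod_cast h4
  exact (Nat.le_succ _).trans h5

section Spectrum

variable {d : ℕ} (b : OrthonormalBasis (Fin d) ℝ (Eucl d)) (c : Eucl d) {r : Fin d → ℝ}

lemma integrable_mul_boxMode {u : Eucl d → ℝ} (hu : MemLp u 2 (volume.restrict (box b c r)))
    (k : Fin d → ℕ) : IntegrableOn (fun x => u x * boxMode b c r k x) (box b c r) := by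
  have := integrable_inner hu (memLp_boxMode b c k)
  rw [IntegrableOn]
  simpa only [RCLike.inner_apply, conj_trivial, mul_comm] using this

/-- After subtraction of the Fourier component along mode `k`, the rest is orthogonal to all modes,
and completeness applies. -/
lemma ae_eq_smul_boxMode (hr : ∀ i, 0 < r i) {u : Eucl d → ℝ}
    (hu : MemLp u 2 (volume.restrict (box b c r))) (k : Fin d → ℕ)
    (h : ∀ m, m ≠ k → ∫ x in box b c r, u x * boxMode b c r m x = 0) :
    ∃ α : ℝ, ∀ᵐ x ∂(volume.restrict (box b c r)), u x = α * boxMode b c r k x := by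
  set α := ∫ x in box b c r, u x * boxMode b c r k x with hα
  refine ⟨α, ?_⟩
  have hL : MemLp (fun x => u x - α * boxMode b c r k x) 2 (volume.restrict (box b c r)) :=
    hu.sub ((memLp_boxMode b c k).const_mul α)
  have := ae_eq_zero_of_integral_boxMode b c hr hL fun m => by
    have e : ∀ x, (u x - α * boxMode b c r k x) * boxMode b c r m x =
        u x * boxMode b c r m x - α * (boxMode b c r k x * boxMode b c r m x) := fun x => by ring
    simp_rw [e]
    rw [integral_sub (integrable_mul_boxMode b c hu m)
      ((integrable_mul_boxMode b c (memLp_boxMode b c k) m).const_mul α), integral_const_mul,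
      integral_boxMode_mul b c hr]
    by_cases hm : m = k
    · subst hm; simp [hα]
    · rw [h m hm, if_neg (Ne.symm hm)]; simp
  filter_upwards [this] with x hx
  linarith

/-- Every eigenfunction of an orthotope with simple spectrum is a multiple of a mode. -/
lemma eigenspace_box (hr : ∀ i, 0 < r i) (hinj : Function.Injective (boxEigenvalue r)) {μ : ℝ}
    {u : Eucl d → ℝ} (hu : InDirichletEigenspace (box b c r) μ u) :
    (∀ᵐ x ∂(volume.restrict (box b c r)), u x = 0) ∨
      ∃ k, μ = boxEigenvalue r k ∧
        ∃ α : ℝ, ∀ᵐ x ∂(volume.restrict (box b c r)), u x = α * boxMode b c r k x := by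
  have horth : ∀ m, μ ≠ boxEigenvalue r m → ∫ x in box b c r, u x * boxMode b c r m x = 0 :=
    fun m hm => integral_mul_eq_zero_of_ne (isOpen_box b c) (isBounded_box b c) hu
      (inDirichletEigenspace_boxMode b c hr m) hm
  by_cases hk : ∃ k, μ = boxEigenvalue r k
  · obtain ⟨k, rfl⟩ := hk
    exact Or.inr ⟨k, rfl, ae_eq_smul_boxMode b c hr hu.memLp k fun m hm =>
      horth m fun h => hm (hinj h).symm⟩
  · push Not at hk
    exact Or.inl (ae_eq_zero_of_integral_boxMode b c hr hu.memLp fun m => horth m (hk m))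

lemma hasSimpleDirichletSpectrum_box (hr : ∀ i, 0 < r i)
    (hinj : Function.Injective (boxEigenvalue r)) :
    HasSimpleDirichletSpectrum (box b c r) := by
  intro μ u v hu hv
  rcases eigenspace_box b c hr hinj hu with h | ⟨k, hk, α, hα⟩
  · exact ⟨1, 0, by simp, by filter_upwards [h] with x hx; simp [hx]⟩
  rcases eigenspace_box b c hr hinj hv with h | ⟨m, hm, β, hβ⟩
  · exact ⟨0, 1, by simp, by filter_upwards [h] with x hx; simp [hx]⟩
  obtain rfl : k = m := hinj (hk.symm.trans hm)
  by_cases h0 : α = 0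
  · exact ⟨1, 0, by simp, by filter_upwards [hα] with x hx; simp [hx, h0]⟩
  · refine ⟨β, -α, by simp [h0], ?_⟩
    filter_upwards [hα, hβ] with x hx hx'
    rw [hx, hx']; ring

/-- The modes as elements of `L²`. -/
noncomputable def boxModeLp (r : Fin d → ℝ) (k : Fin d → ℕ) :
    Lp ℝ 2 (volume.restrict (box b c r)) :=
  (memLp_boxMode b c k).toLp

lemma inner_boxModeLp (f : Lp ℝ 2 (volume.restrict (box b c r))) (k : Fin d → ℕ) :
    inner ℝ (boxModeLp b c r k) f = ∫ x in box b c r, f x * boxMode b c r k x := by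
  rw [L2.inner_def]
  refine integral_congr_ae ?_
  filter_upwards [(memLp_boxMode b c (r := r) k).coeFn_toLp] with x hx
  rw [boxModeLp, hx]
  simp

lemma orthonormal_boxModeLp (hr : ∀ i, 0 < r i) : Orthonormal ℝ (boxModeLp b c r) := by
  rw [orthonormal_iff_ite]
  intro k m
  rw [inner_boxModeLp, ← integral_boxMode_mul b c hr k m]
  refine integral_congr_ae ?_
  filter_upwards [(memLp_boxMode b c (r := r) m).coeFn_toLp] with x hx
  rw [boxModeLp, hx, mul_comm]

lemma exists_dirichletEigenbasis_box (hr : ∀ i, 0 < r i) (e : ℕ ≃ (Fin d → ℕ))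
    (he : StrictMono (boxEigenvalue r ∘ e)) :
    ∃ (lam : ℕ → ℝ) (φ : HilbertBasis ℕ ℝ (Lp ℝ 2 (volume.restrict (box b c r)))),
      IsDirichletEigenbasis (box b c r) lam φ := by
  have hon : Orthonormal ℝ (boxModeLp b c r ∘ e) :=
    (orthonormal_boxModeLp b c hr).comp e e.injective
  have hbot : (Submodule.span ℝ (range (boxModeLp b c r ∘ e)))ᗮ = ⊥ := by
    rw [eq_bot_iff]
    intro f hf
    rw [Submodule.mem_orthogonal] at hf
    rw [Submodule.mem_bot, Lp.eq_zero_iff_ae_eq_zero]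
    refine ae_eq_zero_of_integral_boxMode b c hr (Lp.memLp f) fun k => ?_
    rw [← inner_boxModeLp]
    exact hf _ (Submodule.subset_span ⟨e.symm k, by simp⟩)
  refine ⟨boxEigenvalue r ∘ e, HilbertBasis.mkOfOrthogonalEqBot hon hbot, he.monotone, fun j => ?_⟩
  rw [HilbertBasis.coe_mkOfOrthogonalEqBot]
  exact (inDirichletEigenspace_boxMode b c hr (e j)).congr_ae
    (memLp_boxMode b c (e j)).coeFn_toLp.symm

/-- The eigenbasis of an orthotope with simple spectrum is unique up to the normalization of its
elements. -/
lemma dirichletEigenbasis_box_unique (hr : ∀ i, 0 < r i)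
    (hinj : Function.Injective (boxEigenvalue r)) {e : ℕ ≃ (Fin d → ℕ)}
    (he : StrictMono (boxEigenvalue r ∘ e)) {lam : ℕ → ℝ}
    {φ : HilbertBasis ℕ ℝ (Lp ℝ 2 (volume.restrict (box b c r)))}
    (hφ : IsDirichletEigenbasis (box b c r) lam φ) (j : ℕ) :
    ∃ α : ℝ, α ≠ 0 ∧
      ∀ᵐ x ∂(volume.restrict (box b c r)), φ j x = α * boxMode b c r (e j) x := by
  have hne : ∀ j, ¬ ∀ᵐ x ∂(volume.restrict (box b c r)), φ j x = 0 := by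
    intro j h
    have h0 : φ j = 0 := Lp.eq_zero_iff_ae_eq_zero.2 h
    have := φ.orthonormal.1 j
    rw [h0, norm_zero] at this
    norm_num at this
  have hex : ∀ j, ∃ k, lam j = boxEigenvalue r k ∧ ∃ α : ℝ, α ≠ 0 ∧
      ∀ᵐ x ∂(volume.restrict (box b c r)), φ j x = α * boxMode b c r k x := by
    intro j
    rcases eigenspace_box b c hr hinj (hφ.eigen j) with h | ⟨k, hk, α, hα⟩
    · exact absurd h (hne j)
    · refine ⟨k, hk, α, ?_, hα⟩
      rintro rfl
      exact hne j (by filter_upwards [hα] with x hx; simp [hx])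
  choose σ hσ α hα0 hα using hex
  have hLp : ∀ j, φ j = α j • boxModeLp b c r (σ j) := by
    intro j
    refine Lp.ext ?_
    filter_upwards [hα j, Lp.coeFn_smul (α j) (boxModeLp b c r (σ j)),
      (memLp_boxMode b c (r := r) (σ j)).coeFn_toLp] with x h1 h2 h3
    rw [h1, h2, Pi.smul_apply, boxModeLp, h3, smul_eq_mul]
  have hon := orthonormal_iff_ite.1 (orthonormal_boxModeLp b c hr)
  -- Two basis elements on the same mode would be proportional and not orthogonal; a mode that is
  -- missed would be orthogonal to the whole basis. So `σ` is a bijection, and the monotonicity of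
  -- `lam` leaves only `e`.
  have hσinj : Function.Injective σ := by
    intro i j hij
    by_contra hne'
    have h1 := (orthonormal_iff_ite.1 φ.orthonormal) i j
    rw [if_neg hne', hLp i, hLp j, inner_smul_left, inner_smul_right, hon, if_pos hij] at h1
    simp [hα0] at h1
  have hσsurj : Function.Surjective σ := by
    intro k
    by_contra! hk
    have h0 : boxModeLp b c r k = 0 := by
      have hz : φ.repr (boxModeLp b c r k) = 0 := by
        ext j
        rw [φ.repr_apply_apply, hLp j, inner_smul_left, hon, if_neg (hk j)]
        simp
      simpa using hz
    have := (orthonormal_boxModeLp b c hr).1 k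
    rw [h0, norm_zero] at this
    norm_num at this
  have hmono : Monotone (boxEigenvalue r ∘ Equiv.ofBijective σ ⟨hσinj, hσsurj⟩) := by
    intro i j hij
    have := hφ.monotone hij
    rwa [hσ i, hσ j] at this
  have heq := strictMono_equiv_unique he hmono
  have hej : σ j = e j := by rw [← heq]; rfl
  exact ⟨α j, hα0 j, by rw [← hej]; exact hα j⟩

end Spectrum

/-! ### Non-vanishing of the coupling terms -/

/-- A reflection carries the direction `(1, …, 1)` to that of `g`; the image of the standard basis
then has the same nonzero inner product with `g` in every direction. -/
lemma exists_orthonormalBasis_inner_ne_zero {d : ℕ} (hd : 1 ≤ d) {g : Eucl d} (hg : g ≠ 0) :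
    ∃ b : OrthonormalBasis (Fin d) ℝ (Eucl d), ∀ i, (inner ℝ (b i) g : ℝ) ≠ 0 := by
  set u : Eucl d := WithLp.toLp 2 fun _ => 1 with hu
  have hu0 : u ≠ 0 := by
    intro h
    have := congrArg (fun v : Eucl d => v ⟨0, hd⟩) h
    simp [hu] at this
  have hgn : ‖g‖ ≠ 0 := norm_ne_zero_iff.2 hg
  have hun : ‖u‖ ≠ 0 := norm_ne_zero_iff.2 hu0
  set v : Eucl d := (‖u‖ / ‖g‖) • g with hv
  have huv : ‖u‖ = ‖v‖ := by
    rw [hv, norm_smul, norm_div, norm_norm, norm_norm, div_mul_cancel₀ _ hgn]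
  set U := (ℝ ∙ (u - v))ᗮ.reflection with hU
  have hUu : U u = v := Submodule.reflection_sub huv
  have hgv : g = (‖g‖ / ‖u‖) • U u := by
    rw [hUu, hv, smul_smul, div_mul_div_cancel₀ hun, div_self hgn, one_smul]
  refine ⟨(EuclideanSpace.basisFun (Fin d) ℝ).map U, fun i => ?_⟩
  rw [OrthonormalBasis.map_apply, hgv, inner_smul_right, LinearIsometryEquiv.inner_map_map]
  refine mul_ne_zero (div_ne_zero hgn hun) ?_
  simp [hu, EuclideanSpace.inner_single_left]

lemma exists_pos_forall_le {d : ℕ} {f : Fin d → ℝ} (hf : ∀ i, 0 < f i) :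
    ∃ κ, 0 < κ ∧ ∀ i, κ ≤ f i := by
  have h : ∀ᶠ κ in 𝓝[>] (0 : ℝ), ∀ i, κ ≤ f i := by
    rw [eventually_all]
    intro i
    exact eventually_nhdsWithin_of_eventually_nhds (eventually_le_nhds (hf i))
  obtain ⟨κ, h1, h2⟩ := (h.and self_mem_nhdsWithin).exists
  exact ⟨κ, h2, h1⟩

/-- Modulo a constant, which is orthogonal to the product of two distinct modes, `Z` is the linear
part plus a remainder. By `hsmall`, the remainder is too small to cancel the linear contribution in
any direction. -/
lemma coupling_ne_zero {d : ℕ} (b : OrthonormalBasis (Fin d) ℝ (Eucl d)) (c : Eucl d)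
    {r : Fin d → ℝ} (hr : ∀ i, 0 < r i) {Z : Eucl d → ℝ} (hZ : IntegrableOn Z (box b c r))
    (g : Eucl d) (m₀ : ℝ) {A : ℝ} (hA : 0 ≤ A)
    (hZA : ∫⁻ x in box b c r, ‖Z x - inner ℝ g x - m₀‖ₑ ≤ ENNReal.ofReal A)
    (hsmall : ∀ i, (∏ j, 2 / r j) * A < |inner ℝ (b i) g| * (r i / Real.pi ^ 2 * (16 / 9)))
    {k m : Fin d → ℕ} (hkm : GridAdj k m) :
    ∫ x in box b c r, Z x * (boxMode b c r k x * boxMode b c r m x) ≠ 0 := by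
  obtain ⟨i, h1, h2⟩ := hkm
  have hω := isOpen_box b c (r := r)
  obtain ⟨C, hC, hCi⟩ := integral_inner_boxMode_mul_of_adj b c hr h1 h2 g
  set Φ : Eucl d → ℝ := fun x => boxMode b c r k x * boxMode b c r m x with hΦ
  have hΦc : Continuous Φ :=
    (contDiff_boxMode b c r k).continuous.mul (contDiff_boxMode b c r m).continuous
  have hΦb := abs_boxMode_mul_le b c hr k m
  have hint : ∀ f : Eucl d → ℝ, Continuous f → IntegrableOn f (box b c r) := fun f hf =>
    memLp_one_iff_integrable.1 (memLp_of_continuous hf hω (isBounded_box b c) 1)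
  have hW : IntegrableOn (fun x => Z x - inner ℝ g x - m₀) (box b c r) :=
    (hZ.sub (hint _ (by fun_prop))).sub (hint _ continuous_const)
  have hWΦ : IntegrableOn (fun x => (Z x - inner ℝ g x - m₀) * Φ x) (box b c r) :=
    hW.mul_bdd (c := ∏ j, 2 / r j) hΦc.aestronglyMeasurable (Eventually.of_forall hΦb)
  have hgΦ : IntegrableOn (fun x => inner ℝ g (x - c) * Φ x) (box b c r) :=
    hint _ (Continuous.mul (by fun_prop) hΦc)
  have hkm : k ≠ m := by
    rintro rfl
    omega
  have hΦ0 : ∫ x in box b c r, Φ x = 0 := by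
    rw [hΦ, integral_boxMode_mul b c hr, if_neg hkm]
  have hsplit : ∫ x in box b c r, Z x * Φ x =
      (∫ x in box b c r, (Z x - inner ℝ g x - m₀) * Φ x) +
        ∫ x in box b c r, inner ℝ g (x - c) * Φ x := by
    have e : ∀ x, Z x * Φ x = ((Z x - inner ℝ g x - m₀) * Φ x + inner ℝ g (x - c) * Φ x) +
        (inner ℝ g c + m₀) * Φ x := by
      intro x; rw [inner_sub_right]; ring
    simp_rw [e]
    have hsum : IntegrableOn (fun x => (Z x - inner ℝ g x - m₀) * Φ x +
        inner ℝ g (x - c) * Φ x) (box b c r) := hWΦ.add hgΦ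
    rw [integral_add hsum ((hint _ hΦc).const_mul _), integral_add hWΦ hgΦ, integral_const_mul, hΦ0, mul_zero, add_zero]
  have hbound : |∫ x in box b c r, (Z x - inner ℝ g x - m₀) * Φ x| ≤ (∏ j, 2 / r j) * A := by
    have h3 : ∫ x in box b c r, |Z x - inner ℝ g x - m₀| ≤ A := by
      have := ofReal_integral_norm_eq_lintegral_enorm hW
      rw [← this] at hZA
      exact (ENNReal.ofReal_le_ofReal_iff hA).1 hZA
    have hprod : 0 ≤ ∏ j, 2 / r j := Finset.prod_nonneg fun j _ => by have := hr j; positivity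
    calc _ ≤ ∫ x in box b c r, |(Z x - inner ℝ g x - m₀) * Φ x| := abs_integral_le_integral_abs
      _ ≤ ∫ x in box b c r, (∏ j, 2 / r j) * |Z x - inner ℝ g x - m₀| := by
          refine integral_mono hWΦ.abs (hW.abs.const_mul _) fun x => ?_
          simp only [abs_mul]
          rw [mul_comm]
          exact mul_le_mul_of_nonneg_right (hΦb x) (abs_nonneg _)
      _ ≤ (∏ j, 2 / r j) * A := by
          rw [integral_const_mul]
          exact mul_le_mul_of_nonneg_left h3 hprod
  intro hzero
  change ∫ x in box b c r, Z x * Φ x = 0 at hzero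
  rw [hsplit, hCi] at hzero
  have heq : ∫ x in box b c r, (Z x - inner ℝ g x - m₀) * Φ x =
      inner ℝ (b i) g * (r i / Real.pi ^ 2 * C) := by linarith
  have hri : 0 ≤ r i / Real.pi ^ 2 := by have := hr i; positivity
  rw [heq, abs_mul, abs_of_nonneg (mul_nonneg hri (by linarith))] at hbound
  have h4 : |inner ℝ (b i) g| * (r i / Real.pi ^ 2 * (16 / 9)) ≤
      |inner ℝ (b i) g| * (r i / Real.pi ^ 2 * C) := by gcongr
  linarith [hsmall i]

theorem lemma4p1 {d : ℕ} (hd : 1 ≤ d) (Ω : Set (Eucl d)) (hΩ : IsBoundedDomainOrUniv Ω)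
    (Z : Eucl d → ℝ) (hZ : IsAbsolutelyContinuousOn Z Ω)
    (hZne : ∃ x ∈ Ω, ∃ y ∈ Ω, Z x ≠ Z y) :
    ∃ ω : Set (Eucl d),
      IsBoundedDomain ω ∧ IsOrthotope ω ∧ HasLipschitzBoundary ω ∧ CompactlyContained ω Ω ∧
      HasSimpleDirichletSpectrum ω ∧
      (∃ (lam : ℕ → ℝ) (φ : HilbertBasis ℕ ℝ (Lp ℝ 2 (volume.restrict ω))),
        IsDirichletEigenbasis ω lam φ) ∧
      ∃ h : Equiv.Perm ℕ,
        ∀ (lam : ℕ → ℝ) (φ : HilbertBasis ℕ ℝ (Lp ℝ 2 (volume.restrict ω))),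
          IsDirichletEigenbasis ω lam φ →
            ∀ l : ℕ, ∫ x in ω, Z x * φ (h l) x * φ (h (l + 1)) x ≠ 0 := by
  have hΩo : IsOpen Ω := by
    rcases hΩ with h | rfl
    · exact h.isOpen
    · exact isOpen_univ
  have hΩc : IsPreconnected Ω := by
    rcases hΩ with h | rfl
    · exact h.isConnected.isPreconnected
    · exact isPreconnected_univ
  obtain ⟨c, g, hg, hdiff⟩ := exists_L1_differentiable_point hd hΩo hΩc hZ hZne
  obtain ⟨b, hb⟩ := exists_orthonormalBasis_inner_ne_zero hd hg
  obtain ⟨ρ, hρ, hρinj⟩ := exists_sides_injective d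
  have hpi := Real.pi_pos
  obtain ⟨κ, hκ, hκi⟩ := exists_pos_forall_le (f := fun i =>
    |inner ℝ (b i) g| * (ρ i / Real.pi ^ 2 * (16 / 9)))
    fun i => by have := hρ i; have := abs_pos.2 (hb i); positivity
  set R := √(∑ i, ρ i ^ 2) with hR
  have hsum : 0 < ∑ i, ρ i ^ 2 :=
    Finset.sum_pos (fun i _ => pow_pos (hρ i) 2) ⟨⟨0, hd⟩, Finset.mem_univ _⟩
  have hR0 : 0 < R := Real.sqrt_pos.2 hsum
  have hRsq : R ^ 2 = ∑ i, ρ i ^ 2 := Real.sq_sqrt hsum.le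
  have hP : 0 < ∏ j, 2 / ρ j := Finset.prod_pos fun j _ => by have := hρ j; positivity
  -- With this value the remainder contributes at most `ε * κ / 2` for the box scaled by `ε`,
  -- against at least `ε * κ` from the linear part. As `η` does not involve `ε`, the scale can be
  -- chosen afterwards.
  set η := κ / (2 * ((∏ j, 2 / ρ j) * R ^ (d + 1))) with hη
  have hη0 : 0 < η := by positivity
  obtain ⟨δ, hδ, hδ'⟩ := hdiff η hη0
  set ε := δ / (2 * R) with hε
  have hε0 : 0 < ε := by positivity
  have hεR : ε * R < δ := by
    rw [hε]; field_simp; linarith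
  obtain ⟨hball, m₀, hm₀⟩ := hδ' (ε * R) (by positivity) hεR
  set r : Fin d → ℝ := fun i => ε * ρ i with hr'
  have hr : ∀ i, 0 < r i := fun i => mul_pos hε0 (hρ i)
  have hcl : closure (box b c r) ⊆ Metric.closedBall c (ε * R) := by
    refine (closure_box_subset b c).trans (closedBox_subset_closedBall b c (by positivity) ?_)
    simp only [hr', mul_pow]
    rw [← Finset.mul_sum, hRsq]
  have hsub : box b c r ⊆ Metric.closedBall c (ε * R) := subset_closure.trans hcl
  -- Scaling all sides by `ε` multiplies all eigenvalues by one factor, so the spectrum stays simple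
  -- at every scale.
  have hinj : Function.Injective (boxEigenvalue r) := by
    intro k m hkm
    apply hρinj
    have e : ∀ k, boxEigenvalue r k = (Real.pi / ε) ^ 2 * ∑ i, (((k i : ℝ) + 1) / ρ i) ^ 2 := by
      intro k
      rw [boxEigenvalue, Finset.mul_sum]
      refine Finset.sum_congr rfl fun i _ => ?_
      have := (hρ i).ne'
      simp only [hr']
      field_simp
    rw [e, e] at hkm
    exact mul_left_cancel₀ (by positivity) hkm
  have hdne : Nonempty (Fin d) := ⟨⟨0, hd⟩⟩
  obtain ⟨e, he⟩ := exists_equiv_nat_strictMono (boxEigenvalue r) hinj (finite_boxEigenvalue_le hr)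
  obtain ⟨p, hp⟩ : ∃ p : ℕ ≃ (Fin d → ℕ), ∀ l, GridAdj (p l) (p (l + 1)) := by
    obtain ⟨n, rfl⟩ := Nat.exists_eq_add_of_le' hd
    exact exists_grid_path n
  have hZint : IntegrableOn Z (box b c r) :=
    ((hZ.continuousOn.mono hball).integrableOn_compact (isCompact_closedBall c _)).mono_set hsub
  have hsmall : ∀ i, (∏ j, 2 / r j) * (η * (ε * R) ^ (d + 1)) <
      |inner ℝ (b i) g| * (r i / Real.pi ^ 2 * (16 / 9)) := by
    intro i
    have e1 : ∏ j, 2 / r j = (∏ j, 2 / ρ j) / ε ^ d := by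
      have : ∀ j, 2 / r j = (2 / ρ j) / ε := by
        intro j
        simp only [hr']
        rw [div_div, mul_comm]
      simp_rw [this]
      rw [Finset.prod_div_distrib]
      simp
    have e2 : (∏ j, 2 / r j) * (η * (ε * R) ^ (d + 1)) = ε * (κ / 2) := by
      rw [e1, hη]
      field_simp
      rw [mul_pow]
      ring
    have e3 : |inner ℝ (b i) g| * (r i / Real.pi ^ 2 * (16 / 9)) =
        ε * (|inner ℝ (b i) g| * (ρ i / Real.pi ^ 2 * (16 / 9))) := by
      simp only [hr']; ring
    rw [e2, e3]
    have := hκi i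
    exact mul_lt_mul_of_pos_left (by linarith) hε0
  refine ⟨box b c r, isBoundedDomain_box b c hr, ⟨b, c, r, hr, rfl⟩,
    hasLipschitzBoundary_box b c hr, ⟨(isBounded_box b c).isCompact_closure, hcl.trans hball⟩,
    hasSimpleDirichletSpectrum_box b c hr hinj, exists_dirichletEigenbasis_box b c hr e he,
    -- `h l` is the rank, among the eigenvalues, of the `l`-th vertex of the path: `e (h l) = p l`.
    -- It is fixed before the eigenbasis, whose normalization only brings in nonzero factors.
    p.trans e.symm, fun lam φ hφ l => ?_⟩
  obtain ⟨α, hα0, hα⟩ := dirichletEigenbasis_box_unique b c hr hinj he hφ ((p.trans e.symm) l)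
  obtain ⟨β, hβ0, hβ⟩ :=
    dirichletEigenbasis_box_unique b c hr hinj he hφ ((p.trans e.symm) (l + 1))
  simp only [Equiv.trans_apply, Equiv.apply_symm_apply] at hα hβ
  have hfin : ∫ x in box b c r, Z x * φ ((p.trans e.symm) l) x * φ ((p.trans e.symm) (l + 1)) x =
      α * β * ∫ x in box b c r, Z x * (boxMode b c r (p l) x * boxMode b c r (p (l + 1)) x) := by
    rw [← integral_const_mul]
    refine integral_congr_ae ?_
    filter_upwards [hα, hβ] with x h1 h2
    simp only [Equiv.trans_apply]
    rw [h1, h2]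
    ring
  rw [hfin]
  exact mul_ne_zero (mul_ne_zero hα0 hβ0) (coupling_ne_zero b c hr hZint g m₀ (by positivity)
    ((lintegral_mono_set hsub).trans hm₀) hsmall (hp l))
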